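/- Let $\lambda$ be a nonzero cardinal. Let $\mathrm{ZFC}^-$ denote $\mathrm{ZFC}$ without the power set axiom, with the collection schema and with choice stated as the well-ordering theorem, and let $H(\lambda^+)$ be the set of all $A$ whose transitive closure has size less than $\lambda^+$. For an elementary submodel $M\prec N$ (with respect to $\in$) of a transitive set $N$ let $\pi_M:M\to\bar M$ be the transitive collapse, and put $\bar\lambda_M=\pi_M(\lambda)$ if $\lambda\in M$. Call $M\prec N$ rich if $\lambda\in M$; $\bar\lambda_M\subseteq M$; $\bar\lambda_M$ is an inaccessible cardinal in $N$; $|M|=|\bar\lambda_M|$; $M$ contains every sequence of length less than $\bar\lambda_M$ of elements of $M$; and $\bar\lambda_M<\lambda$. Then the following are equivalent: (1) $\lambda$ is Mahlo (that is, $\lambda$ is inaccessible and the set $\mathrm{Reg}$ of regular cardinals below $\lambda$ is stationary in $\lambda$), and $\diamondsuit_\lambda(\mathrm{Reg})$ holds: there is a sequence $\langle X_\delta:\delta\in\mathrm{Reg}\rangle$ with $X_\delta\subseteq\delta$ such that for every $Y\subseteq\lambda$ the set $\{\delta\in\mathrm{Reg}: Y\cap\delta=X_\delta\}$ is stationary in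 $\lambda$. (2) For every transitive set $N$ which satisfies $\mathrm{ZFC}^-$ and contains every $\lambda^+$-sequence of elements of $N$, there is a function $\ell:\lambda\to V_\lambda$ such that for every $A\in N\cap H(\lambda^+)$ and every $a\subseteq N$ with $|a|<\lambda$ there is a rich $M\prec N$ with $a\cup\{\ell,A\}\subseteq M$ and $\ell(\bar\lambda_M)=\pi_M(A)$. -/

import Mathlib

universe u

namespace MahloLaver

open FirstOrder

/-! ### First-order set theory of a set with the membership relation -/

/-- The relation symbols of the language of set theory: one binary symbol. -/
inductive SetRel : ℕ → Type
  | mem : SetRel 2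

/-- The first-order language of set theory. -/
def setLang : FirstOrder.Language.{0, 0} := ⟨fun _ => Empty, SetRel⟩

/-- Every set `N` is regarded as the structure `(N, ∈)`. -/
instance memStructure (N : ZFSet.{u}) : setLang.Structure N where
  funMap := fun f _ => Empty.elim f
  RelMap := fun {_} r => match r with
    | SetRel.mem => fun x => (x 0 : ZFSet.{u}) ∈ (x 1 : ZFSet.{u})

/-- `M ≺ N`: `M` is a subset of `N` and the inclusion of `(M, ∈)` into `(N, ∈)` is elementary. -/
def IsElementarySubset (M N : ZFSet.{u}) : Prop :=
  ∃ f : M ↪ₑ[setLang] N, ∀ x : M, (f x : ZFSet.{u}) = (x : ZFSet.{u})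

/-- A set of ordered pairs that is one-to-one when read as a function. -/
def IsOneToOne (f : ZFSet.{u}) : Prop :=
  ∀ x y z : ZFSet.{u}, ZFSet.pair x z ∈ f → ZFSet.pair y z ∈ f → x = y

/-- `(N, ∈)` satisfies `ZFC⁻`, that is, `ZFC` without the power set axiom, with the collection
schema and with choice in the form of the well-ordering theorem. All quantifiers range over the
elements of `N`, and the two schemata are for first-order formulas, interpreted in `(N, ∈)`, with
parameters from `N`. The predicate is meant for transitive `N`; the notions "ordinal",
"function", "empty" and "successor of a set" are absolute for these and hence are not relativized.
-/
structure ModelsZFCMinus (N : ZFSet.{u}) : Prop where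
  extensionality : ∀ x ∈ N, ∀ y ∈ N, (∀ z ∈ N, z ∈ x ↔ z ∈ y) → x = y
  foundation : ∀ x ∈ N, (∃ y ∈ N, y ∈ x) → ∃ y ∈ N, y ∈ x ∧ ∀ z ∈ N, z ∈ x → z ∉ y
  pairing : ∀ x ∈ N, ∀ y ∈ N, ∃ z ∈ N, ∀ w ∈ N, w ∈ z ↔ w = x ∨ w = y
  union : ∀ x ∈ N, ∃ y ∈ N, ∀ w ∈ N, w ∈ y ↔ ∃ z ∈ N, z ∈ x ∧ w ∈ z
  infinity : ∃ x ∈ N, ∅ ∈ x ∧ ∀ y ∈ x, insert y y ∈ x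
  separation : ∀ (n : ℕ) (φ : setLang.Formula (Fin (n + 1))) (p : Fin n → N) (x : N),
    ∃ y : N, ∀ w : N, (w : ZFSet.{u}) ∈ (y : ZFSet.{u}) ↔
      (w : ZFSet.{u}) ∈ (x : ZFSet.{u}) ∧ φ.Realize (Fin.cons w p : Fin (n + 1) → N)
  collection : ∀ (n : ℕ) (φ : setLang.Formula (Fin (n + 2))) (p : Fin n → N) (x : N),
    (∀ w : N, (w : ZFSet.{u}) ∈ (x : ZFSet.{u}) →
      ∃ v : N, φ.Realize (Fin.cons w (Fin.cons v p : Fin (n + 1) → N) : Fin (n + 2) → N)) →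
    ∃ y : N, ∀ w : N, (w : ZFSet.{u}) ∈ (x : ZFSet.{u}) →
      ∃ v : N, (v : ZFSet.{u}) ∈ (y : ZFSet.{u}) ∧
        φ.Realize (Fin.cons w (Fin.cons v p : Fin (n + 1) → N) : Fin (n + 2) → N)
  choice : ∀ x ∈ N, ∃ α ∈ N, α.IsOrdinal ∧ ∃ f ∈ N, ZFSet.IsFunc x α f ∧ IsOneToOne f

/-- `N` is closed under `θ`-sequences: every function from the von Neumann ordinal `θ` to `N` is
an element of `N`. -/
def ClosedUnderSeq (θ N : ZFSet.{u}) : Prop :=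
  ∀ f : ZFSet.{u}, ZFSet.IsFunc θ N f → f ∈ N

/-! ### Transitive closure, `H(θ)` and the transitive collapse -/

/-- The transitive closure of `x`. -/
noncomputable def trcl (x : ZFSet.{u}) : ZFSet.{u} :=
  x ∪ ZFSet.iUnion (fun y : x => trcl y)
termination_by x
decreasing_by exact y.2

theorem mem_trcl {x z : ZFSet.{u}} : z ∈ trcl x ↔ z ∈ x ∨ ∃ y ∈ x, z ∈ trcl y := by
  rw [trcl]
  simp

/-- `A ∈ H(θ)`: the transitive closure of `A` has size less than `θ`. -/
def MemH (θ : Cardinal.{u}) (A : ZFSet.{u}) : Prop :=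
  (trcl A).card < θ

/-- The collapsing map `π_M`, given by `π_M(x) = {π_M(y) | y ∈ x ∩ M}`. If `M` is extensional (in
particular if `M` is an elementary substructure of a transitive set), its restriction to `M` is the
isomorphism of `M` with its transitive collapse. -/
noncomputable def collapse (M x : ZFSet.{u}) : ZFSet.{u} :=
  ZFSet.range (fun y : (x ∩ M : ZFSet.{u}) => collapse M y)
termination_by x
decreasing_by exact (ZFSet.mem_inter.1 y.2).1

theorem mem_collapse {M x z : ZFSet.{u}} :
    z ∈ collapse M x ↔ ∃ y ∈ x, y ∈ M ∧ collapse M y = z := by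
  rw [collapse]
  simp [and_assoc]

/-! ### Rich elementary submodels -/

/-- The transitive set `N` satisfies "`κ` is an inaccessible cardinal": `κ` is an uncountable
ordinal, no function in `N` from a smaller ordinal to `κ` is cofinal in `κ`, and for every `α < κ`
the power set of `α` in the sense of `N` exists and is mapped by a one-to-one function in `N` to
some `β < κ`. -/
structure InaccessibleIn (N κ : ZFSet.{u}) : Prop where
  mem : κ ∈ N
  isOrdinal : κ.IsOrdinal
  omega_mem : Ordinal.omega0.toZFSet ∈ κ
  regular : ∀ α ∈ κ, ∀ f ∈ N, ZFSet.IsFunc α κ f →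
    ∃ β ∈ κ, ∀ x ∈ α, ∀ y, ZFSet.pair x y ∈ f → y ∈ β
  strongLimit : ∀ α ∈ κ, ∃ P ∈ N, (∀ x ∈ N, x ∈ P ↔ x ⊆ α) ∧
    ∃ β ∈ κ, ∃ f ∈ N, ZFSet.IsFunc P β f ∧ IsOneToOne f

/-- `M` is a rich elementary submodel of `N`, with respect to the cardinal `lam`. -/
structure IsRich (lam : Cardinal.{u}) (M N : ZFSet.{u}) : Prop where
  elementary : IsElementarySubset M N
  lam_mem : lam.ord.toZFSet ∈ M
  collapse_subset : collapse M lam.ord.toZFSet ⊆ M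
  inaccessible : InaccessibleIn N (collapse M lam.ord.toZFSet)
  card_eq : M.card = (collapse M lam.ord.toZFSet).card
  closed : ∀ α ∈ collapse M lam.ord.toZFSet, ClosedUnderSeq α M
  collapse_lt : collapse M lam.ord.toZFSet ∈ lam.ord.toZFSet

/-! ### Mahlo cardinals and diamond -/

/-- The set of regular cardinals below `lam`, as a set of ordinals below `lam`. -/
def regBelow (lam : Cardinal.{u}) : Set (Set.Iio lam.ord) :=
  {α | ∃ κ : Cardinal.{u}, κ.IsRegular ∧ (α : Ordinal.{u}) = κ.ord}

/-- `lam` is Mahlo. -/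
def IsMahlo (lam : Cardinal.{u}) : Prop :=
  lam.IsInaccessible ∧ IsStationary (regBelow lam)

/-- The diamond principle at `lam` for `S ⊆ lam`. Only the sets `X α` with `α ∈ S` matter. -/
def Diamond (lam : Cardinal.{u}) (S : Set (Set.Iio lam.ord)) : Prop :=
  ∃ X : Set.Iio lam.ord → Set (Set.Iio lam.ord),
    (∀ α ∈ S, X α ⊆ Set.Iio α) ∧
    ∀ Y : Set (Set.Iio lam.ord), IsStationary {α | α ∈ S ∧ Y ∩ Set.Iio α = X α}

/-- `l` is a function from `lam` to `V_lam` that guesses every `A ∈ N ∩ H(lam⁺)` at a rich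
elementary submodel of `N` containing any prescribed subset of `N` of size less than `lam`. -/
def IsGuessing (lam : Cardinal.{u}) (N l : ZFSet.{u}) : Prop :=
  ZFSet.IsFunc lam.ord.toZFSet (ZFSet.vonNeumann lam.ord) l ∧
  ∀ A ∈ N, MemH (Order.succ lam) A → ∀ a : ZFSet.{u}, a ⊆ N → a.card < lam →
    ∃ M : ZFSet.{u}, IsRich lam M N ∧ a ⊆ M ∧ l ∈ M ∧ A ∈ M ∧
      ZFSet.pair (collapse M lam.ord.toZFSet) (collapse M A) ∈ l

end MahloLaver

open MahloLaver

/-!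
Guessing implies diamond. Apply the hypothesis to `N = H(θ)` for a regular uncountable `θ > lam⁺`,
which is a model of `ZFC⁻` (`modelsZFCMinus_hereditary`) and is correct about inaccessibility
(`exists_isRegular_of_inaccessibleIn`). If `M` is rich and `δ = π_M(lam)`, then `δ ⊆ M` forces
`M ∩ lam = δ` (`IsRich.mem_collapse_iff`), so that `π_M` is the identity on `δ` and
`π_M(Y) = Y ∩ δ` for every `Y ⊆ lam`. Since small subsets of `lam` can be put into `M`, this makes
`lam` regular, and it makes `lam` a strong limit because every ordinal below `lam` lies in some
such strong limit `δ`. If a club `C` belongs to `M`, then `δ ∈ C` by elementarity, and `δ` is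
regular. Hence `X_δ = l(δ) ∩ δ` is a diamond sequence, and `lam` is Mahlo
(`isMahlo_and_diamond_of_isGuessing`).

Diamond implies guessing. A model of `ZFC⁻` closed under `lam⁺`-sequences contains all its subsets
of size `lam⁺` (`ModelsZFCMinus.mem_of_card_le`), hence everything of rank at most `lam`. The union
of a chain of elementary subsets, where each stage absorbs the functions into earlier stages
(`exists_chain`), is rich at every regular closure point `δ` of a suitable function
(`exists_rich_at_closurePoints`), and the closure points form a club. Given `A`, enumerate
`{A} ∪ trcl A` as `⟨F ξ | ξ < lam⟩` with `F 0 = A`, and let `Y ⊆ lam` code the relation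
`F η ∈ F ξ` by a pairing function. At `δ`, the collapse `π_M ∘ F` on `δ` is the Mostowski collapse
of the relation coded by `Y ∩ δ`. So if `l(δ)` is what the relation coded by `X_δ` assigns to `0`
(`Decodes`), a guess `X_δ = Y ∩ δ` yields `l(δ) = π_M(A)`.
-/

open Cardinal Ordinal

namespace MahloLaver

/-! ### Maps and cardinalities of sets -/

theorem card_range_le (x : ZFSet.{u}) (h : x → ZFSet.{u}) :
    (ZFSet.range h).card ≤ x.card := by
  have := ZFSet.lift_card_range_le (f := h)
  rwa [ZFSet.cardinalMk_coe_sort, Cardinal.lift_lift, Cardinal.lift_umax.{u, u+1},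
    Cardinal.lift_le] at this

theorem card_le_of_injOn {x y : ZFSet.{u}} {h : ZFSet.{u} → ZFSet.{u}} (hy : ∀ a ∈ x, h a ∈ y)
    (hi : ∀ a ∈ x, ∀ b ∈ x, h a = h b → a = b) : x.card ≤ y.card := by
  rw [← Cardinal.lift_le.{u + 1}, ← ZFSet.cardinalMk_coe_sort, ← ZFSet.cardinalMk_coe_sort]
  exact Cardinal.mk_le_of_injective (f := fun a : x => (⟨h a, hy a a.2⟩ : y))
    fun a b e => Subtype.ext (hi a a.2 b b.2 (congrArg Subtype.val e))

theorem exists_injOn_of_card_le {x y : ZFSet.{u}} (hxy : x.card ≤ y.card) :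
    ∃ h : ZFSet.{u} → ZFSet.{u}, (∀ a ∈ x, h a ∈ y) ∧ ∀ a ∈ x, ∀ b ∈ x, h a = h b → a = b := by
  classical
  rw [← Cardinal.lift_le.{u + 1}, ← ZFSet.cardinalMk_coe_sort, ← ZFSet.cardinalMk_coe_sort] at hxy
  obtain ⟨f⟩ := hxy
  refine ⟨fun a => if ha : a ∈ x then f ⟨a, ha⟩ else ∅, fun a ha => ?_, fun a ha b hb e => ?_⟩
  · simp [ha, (f ⟨a, ha⟩).2]
  · simp only [ha, hb, dif_pos] at e
    exact congrArg Subtype.val (f.injective (Subtype.ext e))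

/-- If `y` is at most as large as `x`, some map sends `x` onto `y` up to a default value `d`. -/
theorem exists_surjOn_of_card_le {x y : ZFSet.{u}} (d : ZFSet.{u}) (hyx : y.card ≤ x.card) :
    ∃ h : ZFSet.{u} → ZFSet.{u}, (∀ a, h a ∈ y ∨ h a = d) ∧ ∀ b ∈ y, ∃ a ∈ x, h a = b := by
  classical
  obtain ⟨i, hi, inj⟩ := exists_injOn_of_card_le hyx
  refine ⟨fun a => if H : ∃ b ∈ y, i b = a then H.choose else d, fun a => ?_, fun b hb => ?_⟩
  · dsimp only
    split_ifs with H
    exacts [Or.inl H.choose_spec.1, Or.inr rfl]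
  · refine ⟨i b, hi b hb, ?_⟩
    have H : ∃ c ∈ y, i c = i b := ⟨b, hb, rfl⟩
    simp only [H, dif_pos]
    exact inj _ H.choose_spec.1 _ hb H.choose_spec.2

/-- The restriction of a map `h` to a set `x`, as a set of ordered pairs. -/
noncomputable def graph (h : ZFSet.{u} → ZFSet.{u}) (x : ZFSet.{u}) : ZFSet.{u} :=
  ZFSet.range fun a : x => ZFSet.pair a (h a)

theorem mem_graph {h : ZFSet.{u} → ZFSet.{u}} {x p : ZFSet.{u}} :
    p ∈ graph h x ↔ ∃ a ∈ x, ZFSet.pair a (h a) = p := by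
  simp [graph]

theorem pair_mem_graph {h : ZFSet.{u} → ZFSet.{u}} {x a b : ZFSet.{u}} :
    ZFSet.pair a b ∈ graph h x ↔ a ∈ x ∧ h a = b := by
  simp only [mem_graph, ZFSet.pair_inj]
  constructor
  · rintro ⟨_, h1, rfl, h2⟩
    exact ⟨h1, h2⟩
  · rintro ⟨h1, h2⟩
    exact ⟨a, h1, rfl, h2⟩

theorem isFunc_graph {h : ZFSet.{u} → ZFSet.{u}} {x y : ZFSet.{u}} (hy : ∀ a ∈ x, h a ∈ y) :
    ZFSet.IsFunc x y (graph h x) := by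
  refine ⟨fun p hp => ?_, fun a ha => ⟨h a, pair_mem_graph.2 ⟨ha, rfl⟩, fun b hb => ?_⟩⟩
  · obtain ⟨a, ha, rfl⟩ := mem_graph.1 hp
    exact ZFSet.pair_mem_prod.2 ⟨ha, hy a ha⟩
  · exact (pair_mem_graph.1 hb).2.symm

theorem isOneToOne_graph {h : ZFSet.{u} → ZFSet.{u}} {x : ZFSet.{u}}
    (hi : ∀ a ∈ x, ∀ b ∈ x, h a = h b → a = b) : IsOneToOne (graph h x) := by
  intro a b c ha hb
  rw [pair_mem_graph] at ha hb
  exact hi a ha.1 b hb.1 (ha.2.trans hb.2.symm)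

/-- Every function in the sense of set theory is the graph of a map. -/
theorem exists_eq_graph {x y f : ZFSet.{u}} (hf : ZFSet.IsFunc x y f) :
    ∃ h : ZFSet.{u} → ZFSet.{u}, (∀ a ∈ x, h a ∈ y) ∧ f = graph h x := by
  classical
  refine ⟨fun a => if ha : a ∈ x then (hf.2 a ha).choose else ∅, fun a ha => ?_, ?_⟩
  · simp only [ha, dif_pos]
    exact (ZFSet.pair_mem_prod.1 (hf.1 (hf.2 a ha).choose_spec.1)).2
  · ext p
    rw [mem_graph]
    constructor
    · intro hp
      obtain ⟨a, ha, b, -, rfl⟩ := ZFSet.mem_prod.1 (hf.1 hp)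
      refine ⟨a, ha, ?_⟩
      simp only [ha, dif_pos]
      rw [(hf.2 a ha).unique (hf.2 a ha).choose_spec.1 hp]
    · rintro ⟨a, ha, rfl⟩
      simp only [ha, dif_pos]
      exact (hf.2 a ha).choose_spec.1

theorem card_le_of_isFunc {x y f : ZFSet.{u}} (hf : ZFSet.IsFunc x y f) : f.card ≤ x.card := by
  obtain ⟨h, -, rfl⟩ := exists_eq_graph hf
  exact card_range_le x fun a : x => ZFSet.pair a (h a)

theorem card_le_of_isOneToOne {x y f : ZFSet.{u}} (hf : ZFSet.IsFunc x y f)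
    (h1 : IsOneToOne f) : x.card ≤ y.card := by
  obtain ⟨h, hy, rfl⟩ := exists_eq_graph hf
  exact card_le_of_injOn hy fun a ha b hb e =>
    h1 a b (h b) (pair_mem_graph.2 ⟨ha, e⟩) (pair_mem_graph.2 ⟨hb, rfl⟩)

theorem card_prod_le (x y : ZFSet.{u}) : (ZFSet.prod x y).card ≤ x.card * y.card := by
  rw [← Cardinal.lift_le.{u + 1}, ← ZFSet.cardinalMk_coe_sort, Cardinal.lift_mul,
    ← ZFSet.cardinalMk_coe_sort, ← ZFSet.cardinalMk_coe_sort, Cardinal.mul_def]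
  refine Cardinal.mk_le_of_surjective
    (f := fun p : x × y => (⟨ZFSet.pair p.1 p.2, ZFSet.pair_mem_prod.2 ⟨p.1.2, p.2.2⟩⟩ :
      ZFSet.prod x y)) ?_
  rintro ⟨z, hz⟩
  obtain ⟨a, ha, b, hb, rfl⟩ := ZFSet.mem_prod.1 hz
  exact ⟨(⟨a, ha⟩, ⟨b, hb⟩), rfl⟩

theorem card_iUnion_lt {θ : Cardinal.{u}} (hθ : θ.IsRegular) {x : ZFSet.{u}} (hx : x.card < θ)
    {f : x → ZFSet.{u}} (hf : ∀ y, (f y).card < θ) : (ZFSet.iUnion f).card < θ := by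
  have h1 : ZFSet.iUnion f = ZFSet.iUnion fun i : Shrink.{u} x => f ((equivShrink x).symm i) := by
    ext z
    simp only [ZFSet.mem_iUnion]
    exact (equivShrink x).exists_congr_left (p := fun y => z ∈ f y)
  rw [h1, ← Cardinal.lift_id (ZFSet.card _)]
  exact ZFSet.lift_card_iUnion_le_sum_card.trans_lt
    (Cardinal.sum_lt_of_isRegular hθ hx fun _ => hf _)

/-- A regular cardinal bounds every small family of smaller ordinals. -/
theorem exists_bound_of_isRegular {θ : Cardinal.{u}} (hθ : θ.IsRegular) {x : ZFSet.{u}}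
    (hx : x.card < θ) {o : ZFSet.{u} → Ordinal.{u}} (ho : ∀ y ∈ x, o y < θ.ord) :
    ∃ μ < θ.ord, ∀ y ∈ x, o y < μ := by
  refine ⟨⨆ i : Shrink.{u} x, (o ((equivShrink x).symm i) + 1),
    Ordinal.iSup_add_one_lt_of_lt_cof (by rwa [hθ.cof_ord]) fun i => ho _ (Subtype.prop _),
    fun y hy => ?_⟩
  have := Ordinal.le_iSup (fun i : Shrink.{u} x => o ((equivShrink x).symm i) + 1)
    (equivShrink x ⟨y, hy⟩)
  simp only [Equiv.symm_apply_apply] at this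
  exact (Order.lt_add_one_iff.2 le_rfl).trans_le this

/-! ### The sets hereditarily smaller than a regular cardinal -/

theorem trcl_subset_of_mem {x y : ZFSet.{u}} (h : y ∈ x) : trcl y ⊆ trcl x :=
  fun _ hz => mem_trcl.2 (Or.inr ⟨y, h, hz⟩)

theorem subset_trcl (x : ZFSet.{u}) : x ⊆ trcl x := fun _ hz => mem_trcl.2 (Or.inl hz)

theorem trcl_subset {N : ZFSet.{u}} (hN : N.IsTransitive) (x : ZFSet.{u}) (hx : x ⊆ N) :
    trcl x ⊆ N := by
  induction x using ZFSet.inductionOn with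
  | h x ih =>
    intro z hz
    obtain h | ⟨y, hy, h⟩ := mem_trcl.1 hz
    · exact hx h
    · exact ih y hy (hN y (hx hy)) h

theorem isTransitive_trcl (x : ZFSet.{u}) : (trcl x).IsTransitive := by
  induction x using ZFSet.inductionOn with
  | h x ih =>
    intro z hz
    obtain h | ⟨y, hy, h⟩ := mem_trcl.1 hz
    · exact fun w hw => mem_trcl.2 (Or.inr ⟨z, h, subset_trcl z hw⟩)
    · exact fun w hw => trcl_subset_of_mem hy (ih y hy z h hw)

/-- For regular `θ`, membership in `H(θ)` is hereditary smallness. -/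
theorem memH_iff {θ : Cardinal.{u}} (hθ : θ.IsRegular) {x : ZFSet.{u}} :
    MemH θ x ↔ x.card < θ ∧ ∀ y ∈ x, MemH θ y := by
  constructor
  · exact fun h => ⟨(ZFSet.card_mono (subset_trcl x)).trans_lt h,
      fun y hy => (ZFSet.card_mono (trcl_subset_of_mem hy)).trans_lt h⟩
  · rintro ⟨h1, h2⟩
    rw [MemH, trcl]
    exact ZFSet.card_union_le.trans_lt (Cardinal.add_lt_of_lt hθ.aleph0_le h1
      (card_iUnion_lt hθ h1 fun y => h2 y y.2))

theorem rank_lt_of_memH {θ : Cardinal.{u}} (hθ : θ.IsRegular) {x : ZFSet.{u}} (hx : MemH θ x) :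
    x.rank < θ.ord := by
  induction x using ZFSet.inductionOn with
  | h x ih =>
    obtain ⟨h1, h2⟩ := (memH_iff hθ).1 hx
    obtain ⟨μ, hμ, h⟩ := exists_bound_of_isRegular hθ h1 fun y hy => ih y hy (h2 y hy)
    exact (ZFSet.rank_le_iff.2 h).trans_lt hμ

/-- The set `H(θ)` of the sets whose transitive closure has size less than `θ`. -/
noncomputable def hereditary (θ : Cardinal.{u}) : ZFSet.{u} :=
  (ZFSet.vonNeumann θ.ord).sep (MemH θ)

theorem mem_hereditary {θ : Cardinal.{u}} (hθ : θ.IsRegular) {x : ZFSet.{u}} :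
    x ∈ hereditary θ ↔ x.card < θ ∧ x ⊆ hereditary θ := by
  have key (y : ZFSet.{u}) : y ∈ hereditary θ ↔ MemH θ y := by
    rw [hereditary, ZFSet.mem_sep, ZFSet.mem_vonNeumann]
    exact ⟨And.right, fun h => ⟨rank_lt_of_memH hθ h, h⟩⟩
  rw [key, memH_iff hθ, ZFSet.subset_def]
  simp only [key]

theorem isTransitive_hereditary {θ : Cardinal.{u}} (hθ : θ.IsRegular) :
    (hereditary θ).IsTransitive := fun _ hx => ((mem_hereditary hθ).1 hx).2

theorem hereditary_of_subset {θ : Cardinal.{u}} (hθ : θ.IsRegular) {x y : ZFSet.{u}}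
    (hx : x ∈ hereditary θ) (hy : y ⊆ x) : y ∈ hereditary θ :=
  (mem_hereditary hθ).2 ⟨(ZFSet.card_mono hy).trans_lt ((mem_hereditary hθ).1 hx).1,
    fun _ hz => ((mem_hereditary hθ).1 hx).2 (hy hz)⟩

theorem empty_mem_hereditary {θ : Cardinal.{u}} (hθ : θ.IsRegular) : ∅ ∈ hereditary θ :=
  (mem_hereditary hθ).2 ⟨by simpa using hθ.pos, ZFSet.empty_subset _⟩

theorem insert_mem_hereditary {θ : Cardinal.{u}} (hθ : θ.IsRegular) {x y : ZFSet.{u}}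
    (hx : x ∈ hereditary θ) (hy : y ∈ hereditary θ) : insert x y ∈ hereditary θ := by
  refine (mem_hereditary hθ).2 ⟨ZFSet.card_insert_le.trans_lt (Cardinal.add_lt_of_lt hθ.aleph0_le
    ((mem_hereditary hθ).1 hy).1 (by simpa using hθ.nat_lt 1)), fun z hz => ?_⟩
  obtain rfl | hz := ZFSet.mem_insert_iff.1 hz
  exacts [hx, ((mem_hereditary hθ).1 hy).2 hz]

theorem pair_mem_hereditary {θ : Cardinal.{u}} (hθ : θ.IsRegular) {x y : ZFSet.{u}}
    (hx : x ∈ hereditary θ) (hy : y ∈ hereditary θ) : ZFSet.pair x y ∈ hereditary θ := by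
  have h (z : ZFSet.{u}) (hz : z ∈ hereditary θ) : {z} ∈ hereditary θ := by
    rw [← insert_empty_eq]
    exact insert_mem_hereditary hθ hz (empty_mem_hereditary hθ)
  exact insert_mem_hereditary hθ (h x hx) (h _ (insert_mem_hereditary hθ hx (h y hy)))

theorem isFunc_mem_hereditary {θ : Cardinal.{u}} (hθ : θ.IsRegular) {x y f : ZFSet.{u}}
    (hx : x.card < θ) (hxN : x ⊆ hereditary θ) (hy : y ⊆ hereditary θ) (hf : ZFSet.IsFunc x y f) :
    f ∈ hereditary θ := by
  refine (mem_hereditary hθ).2 ⟨(card_le_of_isFunc hf).trans_lt hx, fun p hp => ?_⟩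
  obtain ⟨a, ha, b, hb, rfl⟩ := ZFSet.mem_prod.1 (hf.1 hp)
  exact pair_mem_hereditary hθ (hxN ha) (hy hb)

theorem toZFSet_mem_hereditary {θ : Cardinal.{u}} (hθ : θ.IsRegular) {α : Ordinal.{u}}
    (hα : α < θ.ord) : α.toZFSet ∈ hereditary θ := by
  induction α using WellFoundedLT.induction with
  | ind α ih =>
    refine (mem_hereditary hθ).2 ⟨by simpa using Cardinal.lt_ord.1 hα, fun x hx => ?_⟩
    obtain ⟨β, hβ, rfl⟩ := Ordinal.mem_toZFSet_iff.1 hx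
    exact ih β hβ (hβ.trans hα)

theorem closedUnderSeq_hereditary {θ : Cardinal.{u}} (hθ : θ.IsRegular) {α : Ordinal.{u}}
    (hα : α < θ.ord) : ClosedUnderSeq α.toZFSet (hereditary θ) := fun _ hf =>
  isFunc_mem_hereditary hθ ((mem_hereditary hθ).1 (toZFSet_mem_hereditary hθ hα)).1
    ((mem_hereditary hθ).1 (toZFSet_mem_hereditary hθ hα)).2 subset_rfl hf

theorem modelsZFCMinus_hereditary {θ : Cardinal.{u}} (hθ : θ.IsRegular) (h0 : ℵ₀ < θ) :
    ModelsZFCMinus (hereditary θ) where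
  extensionality x hx y hy h := by
    ext z
    exact ⟨fun hz => (h z (isTransitive_hereditary hθ x hx hz)).1 hz,
      fun hz => (h z (isTransitive_hereditary hθ y hy hz)).2 hz⟩
  foundation x hx := by
    rintro ⟨y, -, hy⟩
    obtain ⟨z, hz, hzx⟩ := ZFSet.regularity x (by rintro rfl; exact ZFSet.notMem_empty _ hy)
    refine ⟨z, isTransitive_hereditary hθ x hx hz, hz, fun w _ hw hwz => ?_⟩
    exact ZFSet.notMem_empty w (hzx ▸ ZFSet.mem_inter.2 ⟨hw, hwz⟩)
  pairing x hx y hy := by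
    refine ⟨{x, y}, insert_mem_hereditary hθ hx ?_, fun w _ => ZFSet.mem_pair⟩
    rw [← insert_empty_eq]
    exact insert_mem_hereditary hθ hy (empty_mem_hereditary hθ)
  union x hx := by
    have hxN := (mem_hereditary hθ).1 hx
    refine ⟨ZFSet.iUnion fun y : x => y.1, (mem_hereditary hθ).2 ⟨card_iUnion_lt hθ hxN.1 fun y =>
      ((mem_hereditary hθ).1 (hxN.2 y.2)).1, fun w hw => ?_⟩, fun w _ => ?_⟩
    · obtain ⟨y, hy⟩ := ZFSet.mem_iUnion.1 hw
      exact isTransitive_hereditary hθ _ (hxN.2 y.2) hy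
    · rw [ZFSet.mem_iUnion]
      exact ⟨fun ⟨y, hy⟩ => ⟨y, hxN.2 y.2, y.2, hy⟩, fun ⟨y, _, hy, hw⟩ => ⟨⟨y, hy⟩, hw⟩⟩
  infinity := by
    refine ⟨Ordinal.omega0.toZFSet, toZFSet_mem_hereditary hθ ?_, ?_, fun y hy => ?_⟩
    · rwa [Cardinal.lt_ord, Ordinal.card_omega0]
    · rw [← Ordinal.toZFSet_zero, Ordinal.toZFSet_mem_toZFSet_iff]
      exact Ordinal.omega0_pos
    · obtain ⟨n, hn, rfl⟩ := Ordinal.mem_toZFSet_iff.1 hy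
      rw [← Ordinal.toZFSet_add_one, Ordinal.toZFSet_mem_toZFSet_iff]
      exact Ordinal.isSuccLimit_omega0.add_one_lt hn
  separation n φ p x := by
    classical
    let P : ZFSet.{u} → Prop := fun w => ∃ hw : w ∈ hereditary θ,
      φ.Realize (Fin.cons ⟨w, hw⟩ p : Fin (n + 1) → hereditary θ)
    refine ⟨⟨x.1.sep P, hereditary_of_subset hθ x.2 ZFSet.sep_subset⟩, fun w => ?_⟩
    simp only [ZFSet.mem_sep]
    exact and_congr_right fun _ => ⟨fun ⟨_, h⟩ => h, fun h => ⟨w.2, h⟩⟩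
  collection n φ p x hx := by
    have hxN := (mem_hereditary hθ).1 x.2
    choose v hv using hx
    let r : x.1 → ZFSet.{u} := fun w => v ⟨w, hxN.2 w.2⟩ w.2
    refine ⟨⟨ZFSet.range r, (mem_hereditary hθ).2 ⟨(card_range_le _ r).trans_lt hxN.1,
      fun z hz => ?_⟩⟩, fun w hw => ⟨v w hw, ?_, hv w hw⟩⟩
    · obtain ⟨w, rfl⟩ := ZFSet.mem_range.1 hz
      exact (v _ _).2
    · exact ZFSet.mem_range.2 ⟨⟨w, hw⟩, rfl⟩
  choice x hx := by
    have hxN := (mem_hereditary hθ).1 hx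
    have hα : x.card.ord.toZFSet ∈ hereditary θ :=
      toZFSet_mem_hereditary hθ (Cardinal.ord_lt_ord.2 hxN.1)
    obtain ⟨h, h1, h2⟩ := exists_injOn_of_card_le (x := x) (y := x.card.ord.toZFSet) (by simp)
    exact ⟨_, hα, ZFSet.isOrdinal_toZFSet _, graph h x, isFunc_mem_hereditary hθ hxN.1 hxN.2
      (isTransitive_hereditary hθ _ hα) (isFunc_graph h1), isFunc_graph h1, isOneToOne_graph h2⟩

/-! ### From guessing to diamond -/

/-- The collapse is the identity on transitive subsets of `M`. -/
theorem collapse_eq_self {M T : ZFSet.{u}} (hT : T.IsTransitive) (hTM : T ⊆ M) {x : ZFSet.{u}}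
    (hx : x ⊆ T) : collapse M x = x := by
  induction x using ZFSet.inductionOn with
  | h x ih =>
    have h (y : ZFSet.{u}) (hy : y ∈ x) : collapse M y = y := ih y hy (hT y (hx hy))
    ext z
    rw [mem_collapse]
    constructor
    · rintro ⟨y, hy, -, rfl⟩
      rwa [h y hy]
    · exact fun hz => ⟨z, hz, hTM (hx hz), h z hz⟩

/-- For a rich `M` with `δ = π_M(lam)`, the inclusion `δ ⊆ M` forces `M ∩ lam = δ`: an element of
`M ∩ lam` that is not in `δ` would collapse to an element of `δ` that includes `δ`. -/
theorem IsRich.mem_collapse_iff {lam : Cardinal.{u}} {M N : ZFSet.{u}} (h : IsRich lam M N)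
    {x : ZFSet.{u}} : x ∈ collapse M lam.ord.toZFSet ↔ x ∈ lam.ord.toZFSet ∧ x ∈ M := by
  have hlam := ZFSet.isOrdinal_toZFSet lam.ord
  have ho := h.inaccessible.isOrdinal
  refine ⟨fun hx => ⟨hlam.mem_trans hx h.collapse_lt, h.collapse_subset hx⟩, fun ⟨hx, hxM⟩ => ?_⟩
  by_contra hx'
  rw [ZFSet.IsOrdinal.notMem_iff_subset (hlam.mem hx) ho] at hx'
  have h1 : collapse M x ∈ collapse M lam.ord.toZFSet := mem_collapse.2 ⟨x, hx, hxM, rfl⟩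
  exact ZFSet.mem_irrefl (collapse M x) (mem_collapse.2 ⟨_, hx' h1, h.collapse_subset h1,
    collapse_eq_self ho.isTransitive h.collapse_subset (ho.isTransitive _ h1)⟩)

theorem IsRich.collapse_eq_inter {lam : Cardinal.{u}} {M N Y : ZFSet.{u}} (h : IsRich lam M N)
    (hY : Y ⊆ lam.ord.toZFSet) : collapse M Y = Y ∩ collapse M lam.ord.toZFSet := by
  have hT := h.inaccessible.isOrdinal.isTransitive
  ext z
  rw [mem_collapse, ZFSet.mem_inter]
  constructor
  · rintro ⟨y, hy, hyM, rfl⟩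
    have := h.mem_collapse_iff.2 ⟨hY hy, hyM⟩
    rw [collapse_eq_self hT h.collapse_subset (hT _ this)]
    exact ⟨hy, this⟩
  · rintro ⟨hz, hz'⟩
    exact ⟨z, hz, h.collapse_subset hz', collapse_eq_self hT h.collapse_subset (hT _ hz')⟩

/-- Every ordinal has a cofinal subset whose size is its cofinality. -/
theorem exists_cofinal_subset (δ : Ordinal.{u}) : ∃ S : ZFSet.{u}, S ⊆ δ.toZFSet ∧
    S.card ≤ δ.cof ∧ ∀ α < δ, ∃ β : Ordinal.{u}, α ≤ β ∧ β.toZFSet ∈ S := by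
  obtain ⟨s, hs, hc⟩ := Order.exists_cof_eq (Set.Iio δ)
  rw [Ordinal.cof_Iio, ← Ordinal.lift_cof] at hc
  refine ⟨ZFSet.range fun a : s => a.1.1.toZFSet, fun z hz => ?_, ?_, fun α hα => ?_⟩
  · obtain ⟨a, rfl⟩ := ZFSet.mem_range.1 hz
    exact Ordinal.toZFSet_mem_toZFSet_iff.2 a.1.2
  · have := ZFSet.lift_card_range_le (f := fun a : s => a.1.1.toZFSet)
    rwa [hc, Cardinal.lift_lift, Cardinal.lift_umax.{u, u+1}, Cardinal.lift_le] at this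
  · obtain ⟨b, hb, hab⟩ := hs ⟨α, hα⟩
    exact ⟨b, hab, ZFSet.mem_range.2 ⟨⟨b, hb⟩, rfl⟩⟩

/-- The set `H(θ)` is correct about inaccessibility. -/
theorem exists_isRegular_of_inaccessibleIn {θ : Cardinal.{u}} (hθ : θ.IsRegular) {δ : Ordinal.{u}}
    (h : InaccessibleIn (hereditary θ) δ.toZFSet) :
    ∃ c : Cardinal.{u}, c.IsRegular ∧ δ = c.ord ∧ ∀ d < c, 2 ^ d < c := by
  have hδN := (mem_hereditary hθ).1 h.mem
  have hω : Ordinal.omega0 < δ := Ordinal.toZFSet_mem_toZFSet_iff.1 h.omega_mem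
  have hcof : δ.cof.ord = δ := by
    refine (Ordinal.ord_cof_le δ).antisymm (le_of_not_gt fun hlt => ?_)
    obtain ⟨S, hSδ, hS, hcofin⟩ := exists_cofinal_subset δ
    have h0 : ∅ ∈ δ.toZFSet := by
      rw [← Ordinal.toZFSet_zero, Ordinal.toZFSet_mem_toZFSet_iff]
      exact Ordinal.omega0_pos.trans hω
    have hα := Ordinal.toZFSet_mem_toZFSet_iff.2 hlt
    obtain ⟨g, hg, hgS⟩ := exists_surjOn_of_card_le (x := δ.cof.ord.toZFSet) ∅
      (by simpa using hS)
    have hgδ : ∀ a ∈ δ.cof.ord.toZFSet, g a ∈ δ.toZFSet := fun a _ => by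
      obtain h | h := hg a
      exacts [hSδ h, h ▸ h0]
    have hαN := (mem_hereditary hθ).1 (hδN.2 hα)
    obtain ⟨β, hβ, hb⟩ := h.regular _ hα _ (isFunc_mem_hereditary hθ hαN.1 hαN.2 hδN.2
      (isFunc_graph hgδ)) (isFunc_graph hgδ)
    obtain ⟨β, hβδ, rfl⟩ := Ordinal.mem_toZFSet_iff.1 hβ
    obtain ⟨γ, hγ, hγS⟩ := hcofin β hβδ
    obtain ⟨a, ha, hga⟩ := hgS _ hγS
    have := hb a ha _ (pair_mem_graph.2 ⟨ha, hga⟩)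
    exact (Ordinal.toZFSet_mem_toZFSet_iff.1 this).not_ge hγ
  refine ⟨δ.cof, ⟨?_, by rw [hcof]⟩, hcof.symm, fun d hd => ?_⟩
  · rw [← Cardinal.ord_le_ord, hcof, Cardinal.ord_aleph0]
    exact hω.le
  · have hdδ : d.ord < δ := by
      rw [← hcof]
      exact Cardinal.ord_lt_ord.2 hd
    obtain ⟨P, -, hPx, β, hβ, f, -, hf, hf1⟩ :=
      h.strongLimit _ (Ordinal.toZFSet_mem_toZFSet_iff.2 hdδ)
    obtain ⟨β, hβδ, rfl⟩ := Ordinal.mem_toZFSet_iff.1 hβ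
    have hP : d.ord.toZFSet.powerset ⊆ P := fun x hx => by
      rw [ZFSet.mem_powerset] at hx
      exact (hPx x (hereditary_of_subset hθ
        (hδN.2 (Ordinal.toZFSet_mem_toZFSet_iff.2 hdδ)) hx)).2 hx
    calc 2 ^ d = d.ord.toZFSet.powerset.card := by simp
      _ ≤ P.card := ZFSet.card_mono hP
      _ ≤ β.toZFSet.card := card_le_of_isOneToOne hf hf1
      _ < δ.cof := by
        rw [Ordinal.card_toZFSet, ← Cardinal.lt_ord, hcof]
        exact hβδ

/-- Elementarity for the formula saying that `C` has an element that contains `x`. -/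
theorem IsElementarySubset.exists_mem_between {M N C x y : ZFSet.{u}} (h : IsElementarySubset M N)
    (hC : C ∈ M) (hx : x ∈ M) (hy : y ∈ N) (hyC : y ∈ C) (hxy : x ∈ y) :
    ∃ z ∈ M, z ∈ C ∧ x ∈ z := by
  obtain ⟨f, hf⟩ := h
  let φ : setLang.Formula (Fin 2) :=
    (FirstOrder.Language.Relations.boundedFormula₂ (L := setLang) (n := 1) SetRel.mem
        (.var (Sum.inr 0)) (.var (Sum.inl 0)) ⊓
      FirstOrder.Language.Relations.boundedFormula₂ (L := setLang) (n := 1) SetRel.mem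
        (.var (Sum.inl 1)) (.var (Sum.inr 0))).ex
  have key (K : ZFSet.{u}) (v : Fin 2 → K) :
      φ.Realize v ↔ ∃ z : K, z.1 ∈ (v 0).1 ∧ (v 1).1 ∈ z.1 := by
    simp only [φ, FirstOrder.Language.Formula.Realize,
      FirstOrder.Language.BoundedFormula.realize_ex,
      FirstOrder.Language.BoundedFormula.realize_inf]
    rfl
  have := (f.map_formula φ ![⟨C, hC⟩, ⟨x, hx⟩]).1 ((key N _).2 ⟨⟨y, hy⟩, by simp [hf, hyC, hxy]⟩)
  obtain ⟨z, hz⟩ := (key M _).1 this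
  exact ⟨z, z.2, by simpa using hz⟩

/-- The set of von Neumann ordinals that corresponds to a set of ordinals below `lam`. -/
noncomputable def codeSet {lam : Cardinal.{u}} (Y : Set (Set.Iio lam.ord)) : ZFSet.{u} :=
  lam.ord.toZFSet.sep fun x => ∃ α ∈ Y, α.1.toZFSet = x

theorem codeSet_subset {lam : Cardinal.{u}} (Y : Set (Set.Iio lam.ord)) :
    codeSet Y ⊆ lam.ord.toZFSet := ZFSet.sep_subset

theorem toZFSet_mem_codeSet {lam : Cardinal.{u}} {Y : Set (Set.Iio lam.ord)}
    {α : Set.Iio lam.ord} : α.1.toZFSet ∈ codeSet Y ↔ α ∈ Y := by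
  rw [codeSet, ZFSet.mem_sep]
  constructor
  · rintro ⟨-, β, hβ, h⟩
    rwa [← Subtype.ext (Ordinal.toZFSet_injective h)]
  · exact fun h => ⟨Ordinal.toZFSet_mem_toZFSet_iff.2 α.2, α, h, rfl⟩

theorem isMahlo_and_diamond_of_isGuessing {lam θ : Cardinal.{u}} (hθ : θ.IsRegular)
    (hlam : lam < θ) (h0 : lam ≠ 0) {l : ZFSet.{u}} (hl : IsGuessing lam (hereditary θ) l) :
    IsMahlo lam ∧ Diamond lam (regBelow lam) := by
  have hlamN : lam.ord.toZFSet ∈ hereditary θ :=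
    toZFSet_mem_hereditary hθ (Cardinal.ord_lt_ord.2 hlam)
  have hsub := ((mem_hereditary hθ).1 hlamN).2
  have key (Y a : ZFSet.{u}) (hY : Y ⊆ lam.ord.toZFSet) (ha : a ⊆ hereditary θ)
      (hac : a.card < lam) : ∃ (M : ZFSet.{u}) (c : Cardinal.{u}),
      IsElementarySubset M (hereditary θ) ∧ a ⊆ M ∧ c.IsRegular ∧ c < lam ∧ (∀ d < c, 2 ^ d < c) ∧
      (∀ x, x ∈ c.ord.toZFSet ↔ x ∈ lam.ord.toZFSet ∧ x ∈ M) ∧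
      ZFSet.pair c.ord.toZFSet (Y ∩ c.ord.toZFSet) ∈ l := by
    have hYH : MemH (Order.succ lam) Y := by
      refine Order.lt_succ_iff.2 ((ZFSet.card_mono
        (trcl_subset (ZFSet.isOrdinal_toZFSet _).isTransitive Y hY)).trans ?_)
      simp
    obtain ⟨M, hM, haM, -, -, hp⟩ := hl.2 Y (hereditary_of_subset hθ hlamN hY) hYH a ha hac
    obtain ⟨δ, hδ, hδM⟩ := Ordinal.mem_toZFSet_iff.1 hM.collapse_lt
    have hin := hM.inaccessible
    rw [← hδM] at hin
    obtain ⟨c, hc, rfl, hc2⟩ := exists_isRegular_of_inaccessibleIn hθ hin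
    rw [hM.collapse_eq_inter hY, ← hδM] at hp
    refine ⟨M, c, hM.elementary, haM, hc, Cardinal.ord_lt_ord.1 hδ, hc2, fun x => ?_, hp⟩
    rw [hδM]
    exact hM.mem_collapse_iff
  have hℵ : ℵ₀ < lam := by
    obtain ⟨M, c, -, -, hc, hcl, -⟩ := key ∅ ∅ (ZFSet.empty_subset _) (ZFSet.empty_subset _)
      (by simpa using pos_iff_ne_zero.2 h0)
    exact hc.aleph0_le.trans_lt hcl
  have hone : (1 : Cardinal.{u}) < lam := Cardinal.one_lt_aleph0.trans hℵ
  have hlim := Cardinal.isSuccLimit_ord hℵ.le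
  have hinacc : lam.IsInaccessible := by
    refine ⟨hℵ, le_of_not_gt fun hlt => ?_, fun d hd => ?_⟩
    · -- A short cofinal set of ordinals would be included in `M ∩ lam`, which is bounded.
      obtain ⟨S, hS, hSc, hcofin⟩ := exists_cofinal_subset lam.ord
      obtain ⟨M, c, -, hSM, -, hcl, -, hMc, -⟩ := key ∅ S (ZFSet.empty_subset _)
        (fun _ hx => hsub (hS hx)) (hSc.trans_lt hlt)
      obtain ⟨β, hβ, hβS⟩ := hcofin c.ord (Cardinal.ord_lt_ord.2 hcl)
      exact (Ordinal.toZFSet_mem_toZFSet_iff.1 ((hMc _).2 ⟨hS hβS, hSM hβS⟩)).not_ge hβ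
    · have hdl := Ordinal.toZFSet_mem_toZFSet_iff.2 (Cardinal.ord_lt_ord.2 hd)
      obtain ⟨M, c, -, hdM, -, hcl, hc2, hMc, -⟩ := key ∅ {d.ord.toZFSet} (ZFSet.empty_subset _)
        (fun x hx => by rw [ZFSet.mem_singleton.1 hx]; exact hsub hdl) (by simpa using hone)
      have := (hMc _).2 ⟨hdl, hdM (ZFSet.mem_singleton.2 rfl)⟩
      rw [Ordinal.toZFSet_mem_toZFSet_iff, Cardinal.ord_lt_ord] at this
      exact (hc2 d this).trans hcl
  let X : Set.Iio lam.ord → Set (Set.Iio lam.ord) := fun δ =>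
    {α | α < δ ∧ ∃ z, ZFSet.pair δ.1.toZFSet z ∈ l ∧ α.1.toZFSet ∈ z}
  have hX (Y : Set (Set.Iio lam.ord)) :
      IsStationary {α | α ∈ regBelow lam ∧ Y ∩ Set.Iio α = X α} := by
    intro C hC
    obtain ⟨M, c, hM, hCM, hc, hcl, -, hMc, hp⟩ := key (codeSet Y) {codeSet C} (codeSet_subset Y)
      (fun x hx => by
        rw [ZFSet.mem_singleton.1 hx]
        exact hereditary_of_subset hθ hlamN (codeSet_subset C)) (by simpa using hone)
    let δ : Set.Iio lam.ord := ⟨c.ord, Cardinal.ord_lt_ord.2 hcl⟩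
    have hCmem : codeSet C ∈ M := hCM (ZFSet.mem_singleton.2 rfl)
    -- By elementarity, `C` is unbounded in `δ`.
    have hunb (γ : Set.Iio lam.ord) (hγ : γ < δ) : ∃ ξ ∈ C, γ < ξ ∧ ξ < δ := by
      obtain ⟨ξ, hξC, hξ⟩ := hC.isCofinal ⟨γ.1 + 1, hlim.add_one_lt γ.2⟩
      obtain ⟨z, hzM, hzC, hγz⟩ := hM.exists_mem_between hCmem
        ((hMc _).1 (Ordinal.toZFSet_mem_toZFSet_iff.2 hγ)).2
        (hsub (Ordinal.toZFSet_mem_toZFSet_iff.2 ξ.2)) (toZFSet_mem_codeSet.2 hξC)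
        (Ordinal.toZFSet_mem_toZFSet_iff.2 (Order.add_one_le_iff.1 hξ))
      obtain ⟨ζ, hζ, rfl⟩ := Ordinal.mem_toZFSet_iff.1 (codeSet_subset C hzC)
      exact ⟨⟨ζ, hζ⟩, toZFSet_mem_codeSet.1 hzC, Ordinal.toZFSet_mem_toZFSet_iff.1 hγz,
        Ordinal.toZFSet_mem_toZFSet_iff.1 ((hMc _).2 ⟨codeSet_subset C hzC, hzM⟩)⟩
    have hδC : δ ∈ C := by
      refine hC.isLUB_mem (t := {ξ | ξ ∈ C ∧ ξ < δ}) (fun ξ hξ => hξ.1) ?_ ⟨fun ξ hξ => hξ.2.le,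
        fun b hb => le_of_not_gt fun hlt => ?_⟩
      · obtain ⟨ξ, h1, -, h2⟩ := hunb ⟨0, hlim.bot_lt⟩ hc.ord_pos
        exact ⟨ξ, h1, h2⟩
      · obtain ⟨ξ, h1, h2, h3⟩ := hunb b hlt
        exact (hb ⟨h1, h3⟩).not_gt h2
    refine ⟨δ, ⟨⟨c, hc, rfl⟩, Set.ext fun α => ?_⟩, hδC⟩
    constructor
    · rintro ⟨hα, hαδ⟩
      exact ⟨hαδ, _, hp, ZFSet.mem_inter.2
        ⟨toZFSet_mem_codeSet.2 hα, Ordinal.toZFSet_mem_toZFSet_iff.2 hαδ⟩⟩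
    · rintro ⟨hαδ, z, hz, hαz⟩
      rw [(hl.1.2 _ (Ordinal.toZFSet_mem_toZFSet_iff.2 δ.2)).unique hz hp] at hαz
      exact ⟨toZFSet_mem_codeSet.1 (ZFSet.mem_inter.1 hαz).1, hαδ⟩
  exact ⟨⟨hinacc, (hX ∅).mono fun α hα => hα.1⟩, X, fun α _ β hβ => hβ.1, hX⟩

/-! ### Closure properties of the model -/

theorem ModelsZFCMinus.sUnion_mem {N x : ZFSet.{u}} (hN : N.IsTransitive) (hZ : ModelsZFCMinus N)
    (hx : x ∈ N) : (ZFSet.sUnion x) ∈ N := by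
  obtain ⟨y, hy, h⟩ := hZ.union x hx
  convert hy
  ext w
  rw [ZFSet.mem_sUnion]
  constructor
  · rintro ⟨z, hz, hw⟩
    have hzN := hN x hx hz
    exact (h w (hN z hzN hw)).2 ⟨z, hzN, hz, hw⟩
  · intro hw
    obtain ⟨z, -, hz, hwz⟩ := (h w (hN y hy hw)).1 hw
    exact ⟨z, hz, hwz⟩

theorem ModelsZFCMinus.upair_mem {N x y : ZFSet.{u}} (hN : N.IsTransitive) (hZ : ModelsZFCMinus N)
    (hx : x ∈ N) (hy : y ∈ N) : ({x, y} : ZFSet.{u}) ∈ N := by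
  obtain ⟨z, hz, h⟩ := hZ.pairing x hx y hy
  convert hz
  ext w
  rw [ZFSet.mem_pair]
  constructor
  · rintro (rfl | rfl)
    exacts [(h _ hx).2 (Or.inl rfl), (h _ hy).2 (Or.inr rfl)]
  · exact fun hw => (h w (hN z hz hw)).1 hw

theorem ModelsZFCMinus.singleton_mem {N x : ZFSet.{u}} (hN : N.IsTransitive)
    (hZ : ModelsZFCMinus N) (hx : x ∈ N) : ({x} : ZFSet.{u}) ∈ N := by
  simpa using hZ.upair_mem hN hx hx

theorem ModelsZFCMinus.pair_mem {N x y : ZFSet.{u}} (hN : N.IsTransitive) (hZ : ModelsZFCMinus N)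
    (hx : x ∈ N) (hy : y ∈ N) : ZFSet.pair x y ∈ N :=
  hZ.upair_mem hN (hZ.singleton_mem hN hx) (hZ.upair_mem hN hx hy)

theorem ModelsZFCMinus.empty_mem {N : ZFSet.{u}} (hN : N.IsTransitive) (hZ : ModelsZFCMinus N) :
    ∅ ∈ N := by
  obtain ⟨x, hx, h, -⟩ := hZ.infinity
  exact hN x hx h

theorem ModelsZFCMinus.sdiff_mem {N x y : ZFSet.{u}} (hN : N.IsTransitive) (hZ : ModelsZFCMinus N)
    (hx : x ∈ N) (hy : y ∈ N) : x \ y ∈ N := by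
  obtain ⟨z, h⟩ := hZ.separation 1 (FirstOrder.Language.Relations.formula₂ (L := setLang) SetRel.mem
    (.var 0) (.var 1)).not ![⟨y, hy⟩] ⟨x, hx⟩
  have h' (w : N) : w.1 ∈ z.1 ↔ w.1 ∈ x ∧ w.1 ∉ y := h w
  convert z.2
  ext w
  rw [ZFSet.mem_sdiff]
  exact ⟨fun hw => (h' ⟨w, hN x hx hw.1⟩).2 hw, fun hw => (h' ⟨w, hN z z.2 hw⟩).1 hw⟩

theorem mem_sUnion_sUnion_graph {h : ZFSet.{u} → ZFSet.{u}} {x w : ZFSet.{u}} :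
    w ∈ ZFSet.sUnion (ZFSet.sUnion (graph h x)) ↔ w ∈ x ∨ ∃ a ∈ x, h a = w := by
  simp only [ZFSet.mem_sUnion, mem_graph]
  constructor
  · rintro ⟨s, ⟨_, ⟨a, ha, rfl⟩, hs⟩, hw⟩
    rw [ZFSet.pair, ZFSet.mem_pair] at hs
    obtain rfl | rfl := hs
    · rw [ZFSet.mem_singleton.1 hw]
      exact Or.inl ha
    · obtain rfl | rfl := ZFSet.mem_pair.1 hw
      exacts [Or.inl ha, Or.inr ⟨a, ha, rfl⟩]
  · have key (a : ZFSet.{u}) (ha : a ∈ x) (hw : w = a ∨ w = h a) :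
        ∃ s, (∃ p, (∃ a ∈ x, ZFSet.pair a (h a) = p) ∧ s ∈ p) ∧ w ∈ s :=
      ⟨{a, h a}, ⟨_, ⟨a, ha, rfl⟩, ZFSet.mem_pair.2 (Or.inr rfl)⟩, ZFSet.mem_pair.2 hw⟩
    rintro (hw | ⟨a, ha, rfl⟩)
    exacts [key w hw (Or.inl rfl), key a ha (Or.inr rfl)]

theorem singleton_singleton_notMem_toZFSet (w : ZFSet.{u}) (o : Ordinal.{u}) :
    ({{w}} : ZFSet.{u}) ∉ o.toZFSet := by
  intro h
  have hord := (ZFSet.isOrdinal_toZFSet o).mem h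
  have h1 : w ∈ ({{w}} : ZFSet.{u}) :=
    hord.mem_trans (ZFSet.mem_singleton.2 rfl) (ZFSet.mem_singleton.2 rfl)
  have h2 := ZFSet.mem_singleton.1 h1
  have h3 : w ∈ ({w} : ZFSet.{u}) := ZFSet.mem_singleton.2 rfl
  rw [← h2] at h3
  exact ZFSet.mem_irrefl w h3

/-- A transitive model that is closed under `κ`-sequences contains all its subsets of size `κ`.
The set `x` is recovered from a function with range `{∅} ∪ {{{w}} | w ∈ x}`: its field is the
domain together with `{{{w}} | w ∈ x}`, and these are disjoint since no `{{w}}` is an ordinal. So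
removing the domain is the only instance of separation that is needed. -/
theorem ModelsZFCMinus.mem_of_card_le {N : ZFSet.{u}} (hN : N.IsTransitive) (hZ : ModelsZFCMinus N)
    {κ : Cardinal.{u}} (hκ : κ ≠ 0) (hcl : ClosedUnderSeq κ.ord.toZFSet N) {x : ZFSet.{u}}
    (hx : x ⊆ N) (hxκ : x.card ≤ κ) : x ∈ N := by
  set D := κ.ord.toZFSet with hD
  have h0 : ∅ ∈ D := by
    rw [← Ordinal.toZFSet_zero, Ordinal.toZFSet_mem_toZFSet_iff, Cardinal.lt_ord]
    simpa using pos_iff_ne_zero.2 hκ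
  have field (h : ZFSet.{u} → ZFSet.{u}) (hh : ∀ a ∈ D, h a ∈ N) :
      ZFSet.sUnion (ZFSet.sUnion (graph h D)) ∈ N :=
    hZ.sUnion_mem hN (hZ.sUnion_mem hN (hcl _ (isFunc_graph hh)))
  have hDN : D ⊆ N := fun a ha => hN _ (field (fun _ => ∅) fun _ _ => hZ.empty_mem hN)
    (mem_sUnion_sUnion_graph.2 (Or.inl ha))
  have hDmem : D ∈ N := by
    convert field id fun a ha => hDN ha
    ext w
    rw [mem_sUnion_sUnion_graph]
    simp
  obtain ⟨g, hg, hgx⟩ := exists_surjOn_of_card_le (x := D)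
    (y := ZFSet.range fun w : x => {{w.1}}) ∅ ((card_range_le _ _).trans (by simpa [hD] using hxκ))
  have hgN : ∀ a ∈ D, g a ∈ N := fun a _ => by
    obtain h | h := hg a
    · obtain ⟨w, hw⟩ := ZFSet.mem_range.1 h
      exact hw ▸ hZ.singleton_mem hN (hZ.singleton_mem hN (hx w.2))
    · exact h ▸ hZ.empty_mem hN
  have hEN := hZ.sdiff_mem hN (field g hgN) hDmem
  have hE (s : ZFSet.{u}) : s ∈ ZFSet.sUnion (ZFSet.sUnion (graph g D)) \ D ↔
      (s ∈ D ∨ ∃ a ∈ D, g a = s) ∧ s ∉ D := by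
    rw [ZFSet.mem_sdiff, mem_sUnion_sUnion_graph]
  generalize ZFSet.sUnion (ZFSet.sUnion (graph g D)) \ D = E at hEN hE
  convert hZ.sUnion_mem hN (hZ.sUnion_mem hN hEN)
  ext w
  simp only [ZFSet.mem_sUnion, hE]
  constructor
  · intro hw
    exact ⟨{w}, ⟨{{w}}, ⟨Or.inr (hgx _ (ZFSet.mem_range.2 ⟨⟨w, hw⟩, rfl⟩)),
      singleton_singleton_notMem_toZFSet w _⟩, ZFSet.mem_singleton.2 rfl⟩,
      ZFSet.mem_singleton.2 rfl⟩
  · rintro ⟨t, ⟨s, ⟨hs, hsD⟩, hts⟩, hwt⟩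
    obtain ⟨a, -, rfl⟩ := hs.resolve_left hsD
    obtain h | h := hg a
    · obtain ⟨v, hv⟩ := ZFSet.mem_range.1 h
      rw [← hv, ZFSet.mem_singleton] at hts
      rw [hts, ZFSet.mem_singleton] at hwt
      exact hwt ▸ v.2
    · exact absurd h0 (h ▸ hsD)

theorem ModelsZFCMinus.isFunc_mem {N : ZFSet.{u}} (hN : N.IsTransitive) (hZ : ModelsZFCMinus N)
    {κ : Cardinal.{u}} (hκ : κ ≠ 0) (hcl : ClosedUnderSeq κ.ord.toZFSet N) {x y f : ZFSet.{u}}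
    (hx : x ⊆ N) (hy : y ⊆ N) (hxκ : x.card ≤ κ) (hf : ZFSet.IsFunc x y f) : f ∈ N := by
  refine hZ.mem_of_card_le hN hκ hcl (fun p hp => ?_) ((card_le_of_isFunc hf).trans hxκ)
  obtain ⟨a, ha, b, hb, rfl⟩ := ZFSet.mem_prod.1 (hf.1 hp)
  exact hZ.pair_mem hN (hx ha) (hy hb)

theorem ModelsZFCMinus.mem_of_rank_le {N : ZFSet.{u}} (hN : N.IsTransitive) (hZ : ModelsZFCMinus N)
    {lam κ : Cardinal.{u}} (hlam : lam.IsInaccessible) (hκ : lam ≤ κ)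
    (hcl : ClosedUnderSeq κ.ord.toZFSet N) {x : ZFSet.{u}} (hx : x.rank ≤ lam.ord) : x ∈ N := by
  induction x using ZFSet.inductionOn with
  | h x ih =>
    refine hZ.mem_of_card_le hN (hlam.pos.trans_le hκ).ne' hcl
      (fun y hy => ih y hy ((ZFSet.rank_lt_of_mem hy).le.trans hx)) (le_trans ?_ hκ)
    calc x.card ≤ (ZFSet.vonNeumann lam.ord).card := ZFSet.card_mono (ZFSet.subset_vonNeumann.2 hx)
      _ = lam := by rw [ZFSet.card_vonNeumann, hlam.preBeth_ord]

/-! ### Elementary subsets -/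

/-- The Tarski–Vaught test. -/
theorem isElementarySubset_iff {M N : ZFSet.{u}} : IsElementarySubset M N ↔ M ⊆ N ∧
    ∀ (n : ℕ) (φ : setLang.BoundedFormula Empty (n + 1)) (x : Fin n → N) (a : N),
      (∀ i, (x i).1 ∈ M) → φ.Realize default (Fin.snoc x a : Fin (n + 1) → N) →
        ∃ b : N, b.1 ∈ M ∧ φ.Realize default (Fin.snoc x b : Fin (n + 1) → N) := by
  constructor
  · rintro ⟨f, hf⟩
    refine ⟨fun x hx => by simpa [hf] using (f ⟨x, hx⟩).2, fun n φ x a hx h => ?_⟩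
    let y : Fin n → M := fun i => ⟨x i, hx i⟩
    have hy : f ∘ y = x := funext fun i => Subtype.ext (hf (y i))
    have h1 : φ.ex.Realize (default : Empty → N) x :=
      FirstOrder.Language.BoundedFormula.realize_ex.2 ⟨a, h⟩
    rw [← hy, Subsingleton.elim (default : Empty → N) (f ∘ default), f.map_boundedFormula] at h1
    obtain ⟨b, hb⟩ := FirstOrder.Language.BoundedFormula.realize_ex.1 h1
    refine ⟨f b, by rw [hf]; exact b.2, ?_⟩
    rw [← f.map_boundedFormula, Fin.comp_snoc, hy] at hb
    convert hb
  · rintro ⟨hMN, h⟩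
    let e : FirstOrder.Language.Embedding setLang M N :=
      { toFun := fun x => ⟨x, hMN x.2⟩
        inj' := fun x y hxy => Subtype.ext (congrArg (fun t : N => t.1) hxy)
        map_fun' := fun f _ => Empty.elim f
        map_rel' := fun r x => by cases r; rfl }
    refine ⟨e.toElementaryEmbedding fun n φ x a hφ => ?_, fun x => rfl⟩
    obtain ⟨b, hb, hφb⟩ := h n φ (e ∘ x) a (fun i => (x i).2) hφ
    exact ⟨⟨b, hb⟩, hφb⟩

theorem IsElementarySubset.subset {M N : ZFSet.{u}} (h : IsElementarySubset M N) : M ⊆ N :=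
  (isElementarySubset_iff.1 h).1

/-- A union of a chain of elementary subsets is an elementary subset. -/
theorem isElementarySubset_iUnion {ι : Type*} [LinearOrder ι] [Nonempty ι] [Small.{u} ι]
    {T : ι → ZFSet.{u}} {N : ZFSet.{u}} (hT : ∀ i, IsElementarySubset (T i) N)
    (hmono : ∀ i j, i ≤ j → T i ⊆ T j) : IsElementarySubset (ZFSet.iUnion T) N := by
  refine isElementarySubset_iff.2 ⟨fun x hx => ?_, fun n φ x a hx h => ?_⟩
  · obtain ⟨i, hi⟩ := ZFSet.mem_iUnion.1 hx
    exact (hT i).subset hi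
  · choose k hk using fun i => ZFSet.mem_iUnion.1 (hx i)
    obtain ⟨m, hm⟩ := Finite.exists_le k
    obtain ⟨b, hb, hφ⟩ := (isElementarySubset_iff.1 (hT m)).2 n φ x a
      (fun i => hmono _ _ (hm i) (hk i)) h
    exact ⟨b, ZFSet.mem_iUnion.2 ⟨m, hb⟩, hφ⟩

/-- The downward Löwenheim–Skolem theorem. -/
theorem exists_isElementarySubset {N x : ZFSet.{u}} (hN : ℵ₀ ≤ N.card) (hx : x ⊆ N) :
    ∃ M : ZFSet.{u}, IsElementarySubset M N ∧ x ⊆ M ∧ M.card ≤ max ℵ₀ x.card := by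
  have hcard : setLang.card ≤ ℵ₀ := by
    have : Countable (Σ n, SetRel n) := by
      refine Function.Injective.countable (f := fun r : Σ n, SetRel n => r.1) ?_
      rintro ⟨_, ⟨⟩⟩ ⟨_, ⟨⟩⟩ _
      rfl
    have : Countable (Σ n, setLang.Relations n) := this
    have : IsEmpty (Σ n, setLang.Functions n) := ⟨fun f => Empty.elim f.2⟩
    rw [FirstOrder.Language.card, FirstOrder.Language.Symbols]
    exact Cardinal.mk_le_aleph0_iff.2 inferInstance
  have hs : #{y : N | y.1 ∈ x} ≤ Cardinal.lift.{u + 1} x.card := by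
    rw [← ZFSet.cardinalMk_coe_sort]
    exact Cardinal.mk_le_of_injective (f := fun y => (⟨y.1.1, y.2⟩ : x))
      fun y z h => Subtype.ext (Subtype.ext (congrArg (fun t : x => t.1) h))
  obtain ⟨S, hxS, hS⟩ := FirstOrder.Language.exists_elementarySubstructure_card_eq setLang
    {y : N | y.1 ∈ x} (max ℵ₀ x.card) (le_max_left _ _)
    ((Cardinal.lift_le.2 hs).trans (by simp))
    ((Cardinal.lift_le.2 hcard).trans (by simp))
    (by
      rw [ZFSet.cardinalMk_coe_sort]
      simpa using ⟨hN, ZFSet.card_mono hx⟩)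
  let M : ZFSet.{u} := ZFSet.range fun y : S => y.1.1
  have hM (y : N) : y.1 ∈ M ↔ y ∈ S := by
    rw [ZFSet.mem_range]
    exact ⟨fun ⟨z, hz⟩ => Subtype.ext hz ▸ z.2, fun h => ⟨⟨y, h⟩, rfl⟩⟩
  refine ⟨M, isElementarySubset_iff.2 ⟨fun y hy => ?_, fun n φ v a hv h => ?_⟩, fun y hy => ?_, ?_⟩
  · obtain ⟨z, rfl⟩ := ZFSet.mem_range.1 hy
    exact z.1.2
  · let v' : Fin n → S := fun i => ⟨v i, (hM _).1 (hv i)⟩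
    have h1 : φ.ex.Realize (default : Empty → N) (S.subtype ∘ v') :=
      FirstOrder.Language.BoundedFormula.realize_ex.2 ⟨a, h⟩
    rw [Subsingleton.elim (default : Empty → N) (S.subtype ∘ default),
      S.subtype.map_boundedFormula] at h1
    obtain ⟨b, hb⟩ := FirstOrder.Language.BoundedFormula.realize_ex.1 h1
    refine ⟨b, (hM _).2 b.2, ?_⟩
    rw [← S.subtype.map_boundedFormula, Fin.comp_snoc] at hb
    rwa [Subsingleton.elim (default : Empty → N) (S.subtype ∘ default)]
  · exact (hM ⟨y, hx hy⟩).2 (hxS hy)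
  · have := ZFSet.lift_card_range_le (f := fun y : S => y.1.1)
    rw [← Cardinal.lift_le.{u + 1}, ← hS]
    simpa using this

/-! ### Closure points and chains of elementary subsets -/

theorem exists_bound_initial {lam : Cardinal.{u}} (hlam : lam.IsRegular)
    {o : Ordinal.{u} → Ordinal.{u}} {β : Ordinal.{u}} (hβ : β < lam.ord) (ho : ∀ γ ≤ β, o γ < lam.ord) :
    ∃ μ < lam.ord, ∀ γ ≤ β, o γ < μ := by
  have hβ' := (Cardinal.isSuccLimit_ord hlam.aleph0_le).add_one_lt hβ
  obtain ⟨μ, hμ, h⟩ := exists_bound_of_isRegular hlam (x := (β + 1).toZFSet)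
    (o := fun y => o y.rank) (by rwa [Ordinal.card_toZFSet, ← Cardinal.lt_ord]) fun y hy => by
      obtain ⟨γ, hγ, rfl⟩ := Ordinal.mem_toZFSet_iff.1 hy
      rw [Ordinal.rank_toZFSet]
      exact ho γ (Order.lt_add_one_iff.1 hγ)
  refine ⟨μ, hμ, fun γ hγ => ?_⟩
  have := h γ.toZFSet (Ordinal.toZFSet_mem_toZFSet_iff.2 (Order.lt_add_one_iff.2 hγ))
  rwa [Ordinal.rank_toZFSet] at this

/-- The closure points of a function on an uncountable regular cardinal form a club. -/
theorem isClub_closurePoints {lam : Cardinal.{u}} (hlam : lam.IsRegular) (h0 : ℵ₀ < lam)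
    {H : Ordinal.{u} → Ordinal.{u}} (hH : ∀ β < lam.ord, H β < lam.ord) :
    IsClub {δ : Set.Iio lam.ord | ∀ β < δ.1, H β < δ.1} := by
  refine ⟨fun s hs _ _ x hx β hβ => ?_, fun a => ?_⟩
  · have hβl : β < lam.ord := hβ.trans x.2
    obtain ⟨d, hd, hβd⟩ : ∃ d ∈ s, (⟨β, hβl⟩ : Set.Iio lam.ord) < d := by
      by_contra! hcon
      exact (hx.2 hcon).not_gt hβ
    exact (hs hd β hβd).trans_le (hx.1 hd)
  · have hb (β : Ordinal.{u}) : ∃ μ, β < lam.ord → μ < lam.ord ∧ ∀ γ ≤ β, H γ < μ := by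
      by_cases hβ : β < lam.ord
      · obtain ⟨μ, hμ, h⟩ := exists_bound_initial hlam hβ fun γ hγ => hH γ (hγ.trans_lt hβ)
        exact ⟨μ, fun _ => ⟨hμ, h⟩⟩
      · exact ⟨0, fun h => absurd h hβ⟩
    choose g hg using hb
    have hlt := Cardinal.nfp_lt_ord_of_isRegular hlam h0.ne' (fun β hβ => (hg β hβ).1) a.2
    refine ⟨⟨Ordinal.nfp g a, hlt⟩, fun β hβ => ?_, Ordinal.le_nfp g a⟩
    obtain ⟨n, hn⟩ := Ordinal.lt_nfp_iff.1 hβ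
    have := (hg _ ((Ordinal.iterate_le_nfp g a n).trans_lt hlt)).2 β hn.le
    rw [← Function.iterate_succ_apply' g] at this
    exact this.trans_le (Ordinal.iterate_le_nfp g a _)

/-- The stages of a chain of hulls: stage `γ` is the hull `E` of a set that contains `a`, the
ordinals below `γ`, the sets `F β` for `β < γ`, the earlier stages, and all binary relations
between these elements. The relations are what makes the union of the chain closed under short
sequences. -/
noncomputable def chain (E : ZFSet.{u} → ZFSet.{u}) (a : ZFSet.{u}) (F : Ordinal.{u} → ZFSet.{u})
    (γ : Ordinal.{u}) : ZFSet.{u} :=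
  let U := γ.toZFSet ∪
    ZFSet.iUnion fun y : γ.toZFSet => insert (F y.1.rank) (chain E a F y.1.rank)
  E (a ∪ (U ∪ (ZFSet.prod U U).powerset))
termination_by γ
decreasing_by
  have := ZFSet.rank_lt_of_mem y.2
  rwa [Ordinal.rank_toZFSet] at this

/-- A chain of small elementary subsets of length `lam` in which every function from an ordinal
below `γ` to an earlier stage is an element of stage `γ`. -/
theorem exists_chain {N : ZFSet.{u}} (hN : N.IsTransitive) (hZ : ModelsZFCMinus N)
    {lam κ : Cardinal.{u}} (hlam : lam.IsInaccessible) (hκ : lam ≤ κ)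
    (hcl : ClosedUnderSeq κ.ord.toZFSet N) {a : ZFSet.{u}} (ha : a ⊆ N) (hac : a.card < lam)
    {F : Ordinal.{u} → ZFSet.{u}} (hF : ∀ ξ, F ξ ∈ N) :
    ∃ T : Ordinal.{u} → ZFSet.{u}, ∀ γ < lam.ord, IsElementarySubset (T γ) N ∧ a ⊆ T γ ∧
      (T γ).card < lam ∧ ∀ β < γ, β.toZFSet ∈ T γ ∧ F β ∈ T γ ∧ T β ⊆ T γ ∧
        ∀ α < γ, ∀ f, ZFSet.IsFunc α.toZFSet (T β) f → f ∈ T γ := by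
  have hκ0 := (hlam.pos.trans_le hκ).ne'
  have hord {α : Ordinal.{u}} (hα : α ≤ lam.ord) : α.toZFSet ∈ N :=
    hZ.mem_of_rank_le hN hlam hκ hcl (by simpa using hα)
  have hNinf : ℵ₀ ≤ N.card := by
    refine hlam.aleph0_lt.le.trans ?_
    simpa using ZFSet.card_mono (hN _ (hord le_rfl))
  have hE (x : ZFSet.{u}) : ∃ M : ZFSet.{u}, IsElementarySubset M N ∧ (∀ y ∈ x, y ∈ N → y ∈ M) ∧
      M.card ≤ max ℵ₀ x.card := by
    obtain ⟨M, h1, h2, h3⟩ := exists_isElementarySubset hNinf (x := x ∩ N)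
      fun y hy => (ZFSet.mem_inter.1 hy).2
    exact ⟨M, h1, fun y hy hyN => h2 (ZFSet.mem_inter.2 ⟨hy, hyN⟩), h3.trans
      (max_le_max le_rfl (ZFSet.card_mono fun y hy => (ZFSet.mem_inter.1 hy).1))⟩
  choose E hE1 hE2 hE3 using hE
  have helem (γ : Ordinal.{u}) : IsElementarySubset (chain E a F γ) N := by
    rw [chain]
    exact hE1 _
  refine ⟨chain E a F, fun γ hγ => ⟨helem γ, ?_, ?_, fun β hβ => ?_⟩⟩
  · intro x hx
    rw [chain]
    exact hE2 _ x (ZFSet.mem_union.2 (Or.inl hx)) (ha hx)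
  · induction γ using WellFoundedLT.induction with
    | ind γ ih =>
      rw [chain]
      set U := γ.toZFSet ∪
        ZFSet.iUnion fun y : γ.toZFSet => insert (F y.1.rank) (chain E a F y.1.rank) with hUdef
      have hγc : γ.toZFSet.card < lam := by rwa [Ordinal.card_toZFSet, ← Cardinal.lt_ord]
      have hU : U.card < lam := by
        refine ZFSet.card_union_le.trans_lt (Cardinal.add_lt_of_lt hlam.aleph0_lt.le hγc
          (card_iUnion_lt hlam.isRegular hγc fun y => ZFSet.card_insert_le.trans_lt
            (Cardinal.add_lt_of_lt hlam.aleph0_lt.le ?_ (by simpa using hlam.nat_lt 1))))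
        have hy : y.1.rank < γ := by
          have := ZFSet.rank_lt_of_mem y.2
          rwa [Ordinal.rank_toZFSet] at this
        exact ih _ hy (hy.trans hγ)
      have hP : (ZFSet.prod U U).powerset.card < lam := by
        rw [ZFSet.card_powerset]
        exact hlam.isStrongPrelimit
          ((card_prod_le U U).trans_lt (Cardinal.mul_lt_of_lt hlam.aleph0_lt.le hU hU))
      refine (hE3 _).trans_lt (max_lt hlam.aleph0_lt (ZFSet.card_union_le.trans_lt
        (Cardinal.add_lt_of_lt hlam.aleph0_lt.le hac (ZFSet.card_union_le.trans_lt
          (Cardinal.add_lt_of_lt hlam.aleph0_lt.le hU hP)))))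
  · rw [chain.eq_1 E a F γ]
    set U := γ.toZFSet ∪
      ZFSet.iUnion fun y : γ.toZFSet => insert (F y.1.rank) (chain E a F y.1.rank) with hUdef
    have hUE (x : ZFSet.{u}) (hx : x ∈ U) (hxN : x ∈ N) :
        x ∈ E (a ∪ (U ∪ (ZFSet.prod U U).powerset)) :=
      hE2 _ x (ZFSet.mem_union.2 (Or.inr (ZFSet.mem_union.2 (Or.inl hx)))) hxN
    have hβmem := Ordinal.toZFSet_mem_toZFSet_iff.2 hβ
    have hins : insert (F β) (chain E a F β) ⊆ U := fun x hx =>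
      ZFSet.mem_union.2 (Or.inr (ZFSet.mem_iUnion.2 ⟨⟨_, hβmem⟩, by
        simpa only [Ordinal.rank_toZFSet] using hx⟩))
    refine ⟨hUE _ (ZFSet.mem_union.2 (Or.inl hβmem)) (hord (hβ.trans hγ).le),
      hUE _ (hins (ZFSet.mem_insert _ _)) (hF β),
      fun x hx => hUE _ (hins (ZFSet.mem_insert_of_mem _ hx)) ((helem β).subset hx),
      fun α hα f hf => ?_⟩
    refine hE2 _ f (ZFSet.mem_union.2 (Or.inr (ZFSet.mem_union.2 (Or.inr
      (ZFSet.mem_powerset.2 fun p hp => ?_))))) ?_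
    · obtain ⟨x, hx, y, hy, rfl⟩ := ZFSet.mem_prod.1 (hf.1 hp)
      refine ZFSet.pair_mem_prod.2 ⟨ZFSet.mem_union.2 (Or.inl ?_),
        hins (ZFSet.mem_insert_of_mem _ hy)⟩
      exact (ZFSet.isOrdinal_toZFSet γ).mem_trans hx (Ordinal.toZFSet_mem_toZFSet_iff.2 hα)
    · refine hZ.isFunc_mem hN hκ0 hcl (hN _ (hord (hα.trans hγ).le)) (helem β).subset ?_ hf
      rw [Ordinal.card_toZFSet]
      exact (Cardinal.lt_ord.1 (hα.trans hγ)).le.trans hκ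

theorem rank_collapse_lt {lam : Cardinal.{u}} (hlam : lam.IsRegular) {M : ZFSet.{u}}
    (hM : M.card < lam) (x : ZFSet.{u}) : (collapse M x).rank < lam.ord := by
  induction x using ZFSet.inductionOn with
  | h x ih =>
    obtain ⟨μ, hμ, h⟩ := exists_bound_of_isRegular hlam (x := x ∩ M)
      (o := fun y => (collapse M y).rank)
      ((ZFSet.card_mono fun y hy => (ZFSet.mem_inter.1 hy).2).trans_lt hM)
      fun y hy => ih y (ZFSet.mem_inter.1 hy).1
    refine (ZFSet.rank_le_iff.2 fun z hz => ?_).trans_lt hμ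
    obtain ⟨y, hy, hyM, rfl⟩ := mem_collapse.1 hz
    exact h y (ZFSet.mem_inter.2 ⟨hy, hyM⟩)

/-- Rich elementary subsets with prescribed elements exist at every regular closure point of a
suitable function. The last two conclusions say that the collapse of `M` sees `F` exactly through
its restriction to `c`. -/
theorem exists_rich_at_closurePoints {N : ZFSet.{u}} (hN : N.IsTransitive) (hZ : ModelsZFCMinus N)
    {lam κ : Cardinal.{u}} (hlam : lam.IsInaccessible) (hκ : lam ≤ κ)
    (hcl : ClosedUnderSeq κ.ord.toZFSet N) {a : ZFSet.{u}} (ha : a ⊆ N) (hac : a.card < lam)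
    {F : Ordinal.{u} → ZFSet.{u}} (hF : ∀ ξ, F ξ ∈ N) :
    ∃ H : Ordinal.{u} → Ordinal.{u}, (∀ β < lam.ord, H β < lam.ord) ∧
      ∀ c : Cardinal.{u}, c.IsRegular → c < lam → (∀ β < c.ord, H β < c.ord) →
        ∃ M : ZFSet.{u}, IsRich lam M N ∧ a ⊆ M ∧ M.card < lam ∧
          collapse M lam.ord.toZFSet = c.ord.toZFSet ∧ (∀ ξ < c.ord, F ξ ∈ M) ∧
          ∀ ξ < lam.ord, F ξ ∈ M → ∃ η < c.ord, F η = F ξ := by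
  classical
  have hκ0 := (hlam.pos.trans_le hκ).ne'
  have hmemN {x : ZFSet.{u}} (hx : x.rank ≤ lam.ord) : x ∈ N := hZ.mem_of_rank_le hN hlam hκ hcl hx
  have hlamN : lam.ord.toZFSet ∈ N := hmemN (by simp)
  have ha' : insert lam.ord.toZFSet a ⊆ N := fun x hx => by
    obtain rfl | hx := ZFSet.mem_insert_iff.1 hx
    exacts [hlamN, ha hx]
  obtain ⟨T, hT⟩ := exists_chain hN hZ hlam hκ hcl ha' (ZFSet.card_insert_le.trans_lt
    (Cardinal.add_lt_of_lt hlam.aleph0_lt.le hac (by simpa using hlam.nat_lt 1))) hF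
  have hpos : 0 < lam.ord := hlam.isRegular.ord_pos
  -- Bounds for the ordinals in `T β` and for the indices of its elements in the enumeration `F`.
  have hi (x : ZFSet.{u}) : ∃ i < lam.ord, (∃ ξ < lam.ord, F ξ = x) → F i = x := by
    by_cases h : ∃ ξ < lam.ord, F ξ = x
    · obtain ⟨ξ, h1, h2⟩ := h
      exact ⟨ξ, h1, fun _ => h2⟩
    · exact ⟨0, hpos, fun h' => absurd h' h⟩
  choose i hi1 hi2 using hi
  have hb (β : Ordinal.{u}) : ∃ μ, β < lam.ord → μ < lam.ord ∧ (∀ x ∈ T β, i x < μ) ∧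
      ∀ ζ < lam.ord, ζ.toZFSet ∈ T β → ζ < μ := by
    by_cases hβ : β < lam.ord
    · obtain ⟨-, -, hTc, -⟩ := hT β hβ
      obtain ⟨μ, hμ, h1⟩ := exists_bound_of_isRegular hlam.isRegular hTc fun x _ => hi1 x
      obtain ⟨ν, hν, h2⟩ := exists_bound_of_isRegular hlam.isRegular hTc
        (o := fun x => if x.rank < lam.ord then x.rank else 0) fun x _ => by
          split_ifs with h
          exacts [h, hpos]
      refine ⟨max μ ν, fun _ => ⟨max_lt hμ hν, fun x hx => (h1 x hx).trans_le (le_max_left _ _),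
        fun ζ hζ hζT => ?_⟩⟩
      have := h2 _ hζT
      simp only [Ordinal.rank_toZFSet, hζ, if_true] at this
      exact this.trans_le (le_max_right _ _)
    · exact ⟨0, fun h => absurd h hβ⟩
  choose μ hμ using hb
  refine ⟨fun β => max (max Ordinal.omega0 ((2 : Cardinal.{u}) ^ β.card).ord)
      (max (T β).card.ord (μ β)),
    fun β hβ => max_lt (max_lt ?_ ?_) (max_lt ?_ (hμ β hβ).1), fun c hc hcl' hH => ?_⟩
  · rw [Cardinal.lt_ord, Ordinal.card_omega0]
    exact hlam.aleph0_lt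
  · exact Cardinal.ord_lt_ord.2 (hlam.isStrongPrelimit (Cardinal.lt_ord.1 hβ))
  · exact Cardinal.ord_lt_ord.2 (hT β hβ).2.2.1
  simp only [max_lt_iff] at hH
  have hclam : c.ord < lam.ord := Cardinal.ord_lt_ord.2 hcl'
  have hlim := Cardinal.isSuccLimit_ord hc.aleph0_le
  have hcN : c.ord.toZFSet ∈ N := hmemN (by simpa using hclam.le)
  set M := ZFSet.iUnion fun β : Set.Iio c.ord => T β with hMdef
  have hM {x : ZFSet.{u}} : x ∈ M ↔ ∃ β < c.ord, x ∈ T β := by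
    rw [hMdef, ZFSet.mem_iUnion]
    exact ⟨fun ⟨β, h⟩ => ⟨β, β.2, h⟩, fun ⟨β, hβ, h⟩ => ⟨⟨β, hβ⟩, h⟩⟩
  have hTmono {β γ : Ordinal.{u}} (hγ : γ < c.ord) (h : β ≤ γ) : T β ⊆ T γ := by
    obtain rfl | h := h.eq_or_lt
    · exact subset_rfl
    · exact ((hT γ (hγ.trans hclam)).2.2.2 β h).2.2.1
  have hsucc {β : Ordinal.{u}} (hβ : β < c.ord) := (hT (β + 1)
    ((hlim.add_one_lt hβ).trans hclam)).2.2.2 β (Order.lt_add_one_iff.2 le_rfl)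
  have hT0 := hT 0 hpos
  have hcM : c.ord.toZFSet ⊆ M := fun x hx => by
    obtain ⟨β, hβ, rfl⟩ := Ordinal.mem_toZFSet_iff.1 hx
    exact hM.2 ⟨β + 1, hlim.add_one_lt hβ, (hsucc hβ).1⟩
  have hlamM : lam.ord.toZFSet ∈ M := hM.2 ⟨0, hc.ord_pos, hT0.2.1 (ZFSet.mem_insert _ _)⟩
  have hinter {x : ZFSet.{u}} : x ∈ lam.ord.toZFSet ∧ x ∈ M ↔ x ∈ c.ord.toZFSet := by
    constructor
    · rintro ⟨hx, hxM⟩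
      obtain ⟨ζ, hζ, rfl⟩ := Ordinal.mem_toZFSet_iff.1 hx
      obtain ⟨β, hβ, hxT⟩ := hM.1 hxM
      exact Ordinal.toZFSet_mem_toZFSet_iff.2
        (((hμ β (hβ.trans hclam)).2.2 ζ hζ hxT).trans (hH β hβ).2.2)
    · exact fun hx => ⟨Ordinal.toZFSet_monotone hclam.le hx, hcM hx⟩
  have hcoll : collapse M lam.ord.toZFSet = c.ord.toZFSet := by
    have hself {x : ZFSet.{u}} (hx : x ∈ c.ord.toZFSet) : collapse M x = x :=
      collapse_eq_self (ZFSet.isOrdinal_toZFSet _).isTransitive hcM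
        ((ZFSet.isOrdinal_toZFSet _).isTransitive _ hx)
    ext z
    rw [mem_collapse]
    constructor
    · rintro ⟨y, hy, hyM, rfl⟩
      have := hinter.1 ⟨hy, hyM⟩
      rwa [hself this]
    · intro hz
      exact ⟨z, (hinter.2 hz).1, (hinter.2 hz).2, hself hz⟩
  have hMcard : M.card = c := by
    refine le_antisymm ?_ (by simpa using ZFSet.card_mono hcM)
    rw [← Cardinal.lift_le.{u + 1}]
    refine ZFSet.lift_card_iUnion_le_sum_card.trans ((Cardinal.sum_le_sum
      (fun β : Set.Iio c.ord => (T β).card) (fun _ => c)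
      fun β => (Cardinal.ord_lt_ord.1 (hH β β.2).2.1).le).trans ?_)
    rw [Cardinal.sum_const, Cardinal.mk_Iio_ordinal, Cardinal.card_ord]
    simp [← Cardinal.lift_mul, Cardinal.mul_eq_self hc.aleph0_le]
  have hMelem : IsElementarySubset M N := by
    have : Nonempty (Set.Iio c.ord) := ⟨⟨0, hc.ord_pos⟩⟩
    exact isElementarySubset_iUnion (fun β => (hT β (β.2.trans hclam)).1)
      fun β γ h => hTmono γ.2 h
  refine ⟨M, ⟨hMelem, hlamM, hcoll ▸ hcM, ?_, ?_, ?_, ?_⟩,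
    fun x hx => hM.2 ⟨0, hc.ord_pos, hT0.2.1 (ZFSet.mem_insert_of_mem _ hx)⟩, hMcard ▸ hcl', hcoll,
    fun ξ hξ => hM.2 ⟨ξ + 1, hlim.add_one_lt hξ, (hsucc hξ).2.1⟩, fun ξ hξ hξM => ?_⟩
  · rw [hcoll]
    refine ⟨hcN, ZFSet.isOrdinal_toZFSet _, Ordinal.toZFSet_mem_toZFSet_iff.2
      (hH 0 hc.ord_pos).1.1, fun x hx f _ hf => ?_, fun x hx => ?_⟩
    · obtain ⟨α, hα, rfl⟩ := Ordinal.mem_toZFSet_iff.1 hx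
      obtain ⟨h, hh, rfl⟩ := exists_eq_graph hf
      obtain ⟨ν, hν, hb⟩ := exists_bound_of_isRegular hc (x := α.toZFSet) (o := fun x => (h x).rank)
        (by rw [Ordinal.card_toZFSet]; exact Cardinal.lt_ord.1 hα)
        fun x hx => by
          have := ZFSet.rank_lt_of_mem (hh x hx)
          rwa [Ordinal.rank_toZFSet] at this
      refine ⟨ν.toZFSet, Ordinal.toZFSet_mem_toZFSet_iff.2 hν, fun x hx y hy => ?_⟩
      obtain ⟨-, rfl⟩ := pair_mem_graph.1 hy
      rw [← ((ZFSet.isOrdinal_toZFSet _).mem (hh x hx)).toZFSet_rank_eq,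
        Ordinal.toZFSet_mem_toZFSet_iff]
      exact hb x hx
    · obtain ⟨α, hα, rfl⟩ := Ordinal.mem_toZFSet_iff.1 hx
      have h2 : ((2 : Cardinal.{u}) ^ α.card).ord < c.ord := (hH α hα).1.2
      have hPN : α.toZFSet.powerset ∈ N := hmemN (by
        rw [ZFSet.rank_powerset, Ordinal.rank_toZFSet]
        exact ((hlim.succ_lt hα).trans hclam).le)
      obtain ⟨h, hh1, hh2⟩ := exists_injOn_of_card_le (x := α.toZFSet.powerset)
        (y := ((2 : Cardinal.{u}) ^ α.card).ord.toZFSet) (by simp)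
      have hβN : ((2 : Cardinal.{u}) ^ α.card).ord.toZFSet ∈ N :=
        hN _ hcN (Ordinal.toZFSet_mem_toZFSet_iff.2 h2)
      refine ⟨_, hPN, fun x _ => ZFSet.mem_powerset, _, Ordinal.toZFSet_mem_toZFSet_iff.2 h2,
        graph h _, hZ.isFunc_mem hN hκ0 hcl (hN _ hPN) (hN _ hβN) ?_ (isFunc_graph hh1),
        isFunc_graph hh1, isOneToOne_graph hh2⟩
      rw [ZFSet.card_powerset, Ordinal.card_toZFSet]
      exact ((Cardinal.ord_lt_ord.1 h2).le.trans hcl'.le).trans hκ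
  · rw [hcoll, hMcard, Ordinal.card_toZFSet, Cardinal.card_ord]
  · -- A short sequence of elements of `M` lies in one stage, so it is an element of a later one.
    intro x hx f hf
    rw [hcoll] at hx
    obtain ⟨α, hα, rfl⟩ := Ordinal.mem_toZFSet_iff.1 hx
    obtain ⟨h, hh, rfl⟩ := exists_eq_graph hf
    have hs (x : ZFSet.{u}) : ∃ β < c.ord, x ∈ α.toZFSet → h x ∈ T β := by
      by_cases hx : x ∈ α.toZFSet
      · obtain ⟨β, hβ, hxβ⟩ := hM.1 (hh x hx)
        exact ⟨β, hβ, fun _ => hxβ⟩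
      · exact ⟨0, hc.ord_pos, fun h => absurd h hx⟩
    choose s hs1 hs2 using hs
    obtain ⟨ν, hν, hb⟩ := exists_bound_of_isRegular hc (x := α.toZFSet)
      (by rw [Ordinal.card_toZFSet]; exact Cardinal.lt_ord.1 hα) fun x _ => hs1 x
    have hγ : max α ν < c.ord := max_lt hα hν
    exact hM.2 ⟨max α ν + 1, hlim.add_one_lt hγ, (hsucc hγ).2.2.2 α
      (Order.lt_add_one_iff.2 (le_max_left _ _)) _ (isFunc_graph fun x hx =>
        hTmono hγ ((hb x hx).le.trans (le_max_right _ _)) (hs2 x hx))⟩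
  · rw [hcoll]
    exact Ordinal.toZFSet_mem_toZFSet_iff.2 hclam
  · obtain ⟨β, hβ, hξβ⟩ := hM.1 hξM
    exact ⟨i (F ξ), ((hμ β (hβ.trans hclam)).2.1 _ hξβ).trans (hH β hβ).2.2,
      hi2 _ ⟨ξ, hξ, rfl⟩⟩

/-! ### From diamond to guessing -/

theorem exists_pairing {o : Ordinal.{u}} (ho : ℵ₀ ≤ o.card) :
    ∃ p : Ordinal.{u} → Ordinal.{u} → Ordinal.{u},
      (∀ η < o, ∀ ξ < o, p η ξ < o) ∧
      ∀ η < o, ∀ ξ < o, ∀ η' < o, ∀ ξ' < o, p η ξ = p η' ξ' → η = η' ∧ ξ = ξ' := by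
  classical
  have h : #(Set.Iio o × Set.Iio o) = #(Set.Iio o) := by
    rw [Cardinal.mk_prod, Cardinal.lift_id, Cardinal.mul_eq_self]
    rwa [Cardinal.mk_Iio_ordinal, Cardinal.aleph0_le_lift]
  obtain ⟨e⟩ := Cardinal.eq.1 h
  refine ⟨fun η ξ => if h : η < o ∧ ξ < o then (e (⟨η, h.1⟩, ⟨ξ, h.2⟩)).1 else 0,
    fun η hη ξ hξ => ?_, fun η hη ξ hξ η' hη' ξ' hξ' heq => ?_⟩
  · simp only [hη, hξ, and_self, dif_pos]
    exact (e _).2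
  · simp only [hη, hξ, hη', hξ', and_self, dif_pos] at heq
    obtain ⟨h1, h2⟩ := Prod.mk.inj (e.injective (Subtype.ext heq))
    exact ⟨congrArg Subtype.val h1, congrArg Subtype.val h2⟩

/-- `z` is what the Mostowski collapse `G` of the relation `E` on `δ` assigns to `0`. Neither
well-foundedness nor extensionality of `E` is required: the former follows from the existence of
`G`, the latter is only needed for `G` to be injective. -/
def Decodes (δ : Ordinal.{u}) (E : Ordinal.{u} → Ordinal.{u} → Prop) (z : ZFSet.{u}) : Prop :=
  ∃ G : Ordinal.{u} → ZFSet.{u},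
    (∀ ξ < δ, ∀ w, w ∈ G ξ ↔ ∃ η < δ, E η ξ ∧ G η = w) ∧ G 0 = z

/-- Any solution `G` of the collapsing equation makes `E` well-founded, whence uniqueness. -/
theorem Decodes.unique {δ : Ordinal.{u}} (hδ : 0 < δ) {E : Ordinal.{u} → Ordinal.{u} → Prop}
    {z z' : ZFSet.{u}} (h : Decodes δ E z) (h' : Decodes δ E z') : z = z' := by
  obtain ⟨G, hG, rfl⟩ := h
  obtain ⟨G', hG', rfl⟩ := h'
  suffices H : ∀ x, ∀ ξ < δ, G ξ = x → G' ξ = x from (H _ 0 hδ rfl).symm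
  intro x
  induction x using ZFSet.inductionOn with
  | h x ih =>
    rintro ξ hξ rfl
    have key (η : Ordinal.{u}) (hη : η < δ) (hE : E η ξ) : G' η = G η :=
      ih (G η) ((hG ξ hξ _).2 ⟨η, hη, hE, rfl⟩) η hη rfl
    ext w
    rw [hG ξ hξ, hG' ξ hξ]
    refine exists_congr fun η => and_congr_right fun hη => and_congr_right fun hE => ?_
    rw [key η hη hE]

theorem exists_isGuessing_of_diamond {lam : Cardinal.{u}} (hlam : lam.IsInaccessible)
    (hdia : Diamond lam (regBelow lam)) {N : ZFSet.{u}} (hN : N.IsTransitive)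
    (hZ : ModelsZFCMinus N) (hcl : ClosedUnderSeq (Order.succ lam).ord.toZFSet N) :
    ∃ l : ZFSet.{u}, IsGuessing lam N l := by
  classical
  obtain ⟨X, -, hX⟩ := hdia
  obtain ⟨p, hp1, hp2⟩ := exists_pairing (o := lam.ord) (by simpa using hlam.aleph0_lt.le)
  have hκ := Order.le_succ lam
  have hκ0 := (hlam.pos.trans_le hκ).ne'
  have hmemN {x : ZFSet.{u}} (hx : x.rank ≤ lam.ord) : x ∈ N := hZ.mem_of_rank_le hN hlam hκ hcl hx
  let R : Ordinal.{u} → Ordinal.{u} → Ordinal.{u} → Prop := fun δ η ξ =>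
    ∃ hδ : δ < lam.ord, ∃ α ∈ X ⟨δ, hδ⟩, α.1 = p η ξ
  let d : ZFSet.{u} → ZFSet.{u} := fun x =>
    if h : ∃ z ∈ ZFSet.vonNeumann lam.ord, Decodes x.rank (R x.rank) z then h.choose else ∅
  have hd (x : ZFSet.{u}) : d x ∈ ZFSet.vonNeumann lam.ord := by
    dsimp only [d]
    split_ifs with h
    · exact h.choose_spec.1
    · rw [ZFSet.mem_vonNeumann, ZFSet.rank_empty]
      exact hlam.isRegular.ord_pos
  have hlfun : ZFSet.IsFunc lam.ord.toZFSet (ZFSet.vonNeumann lam.ord)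
      (graph d lam.ord.toZFSet) := isFunc_graph fun x _ => hd x
  have hlN : graph d lam.ord.toZFSet ∈ N := hZ.isFunc_mem hN hκ0 hcl
    (hN _ (hmemN (by simp))) (hN _ (hmemN (by simp))) (by simpa using hκ) hlfun
  refine ⟨_, hlfun, fun A hA hAH a ha hac => ?_⟩
  -- An enumeration `F` of the transitive closure of `{A}` in type `lam`, starting with `A`.
  set S := insert A (trcl A) with hS
  have hSN : S ⊆ N := fun x hx => by
    obtain rfl | hx := ZFSet.mem_insert_iff.1 hx
    exacts [hA, trcl_subset hN A (hN A hA) hx]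
  have hStrans : S.IsTransitive := fun x hx y hy => by
    obtain rfl | hx := ZFSet.mem_insert_iff.1 hx
    exacts [ZFSet.mem_insert_of_mem _ (subset_trcl _ hy),
      ZFSet.mem_insert_of_mem _ (isTransitive_trcl A x hx hy)]
  have hAS : A ∈ S := ZFSet.mem_insert _ _
  obtain ⟨F, hFS, hFsurj, hF0⟩ : ∃ F : Ordinal.{u} → ZFSet.{u}, (∀ ξ, F ξ ∈ S) ∧
      (∀ x ∈ S, ∃ ξ < lam.ord, F ξ = x) ∧ F 0 = A := by
    obtain ⟨g, hg, hgS⟩ := exists_surjOn_of_card_le (x := lam.ord.toZFSet) (y := S) A (by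
      rw [Ordinal.card_toZFSet, Cardinal.card_ord]
      exact ZFSet.card_insert_le.trans (Cardinal.add_le_of_le hlam.aleph0_lt.le
        (Order.lt_succ_iff.1 hAH) (by simpa using (hlam.nat_lt 1).le)))
    have hsurj : ∀ x ∈ S, ∃ ξ < lam.ord, g ξ.toZFSet = x := fun x hx => by
      obtain ⟨y, hy, rfl⟩ := hgS x hx
      obtain ⟨ξ, hξ, rfl⟩ := Ordinal.mem_toZFSet_iff.1 hy
      exact ⟨ξ, hξ, rfl⟩
    obtain ⟨ξ₀, hξ₀, hA₀⟩ := hsurj A hAS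
    refine ⟨fun ξ => g (Equiv.swap 0 ξ₀ ξ).toZFSet, fun ξ => ?_, fun x hx => ?_, by simpa using hA₀⟩
    · dsimp only
      obtain h | h := hg (Equiv.swap 0 ξ₀ ξ).toZFSet
      exacts [h, h ▸ hAS]
    · obtain ⟨ξ, hξ, rfl⟩ := hsurj x hx
      refine ⟨Equiv.swap 0 ξ₀ ξ, ?_, by simp⟩
      rw [Equiv.swap_apply_def]
      split_ifs
      exacts [hξ₀, hlam.isRegular.ord_pos, hξ]
  have ha' : insert (graph d lam.ord.toZFSet) (insert A a) ⊆ N := fun x hx => by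
    obtain rfl | hx := ZFSet.mem_insert_iff.1 hx
    · exact hlN
    · obtain rfl | hx := ZFSet.mem_insert_iff.1 hx
      exacts [hA, ha hx]
  have hone : (1 : Cardinal.{u}) < lam := by simpa using hlam.nat_lt 1
  obtain ⟨H, hH, hrich⟩ := exists_rich_at_closurePoints hN hZ hlam hκ hcl ha'
    (ZFSet.card_insert_le.trans_lt (Cardinal.add_lt_of_lt hlam.aleph0_lt.le
      (ZFSet.card_insert_le.trans_lt (Cardinal.add_lt_of_lt hlam.aleph0_lt.le hac hone)) hone))
    (F := F) fun ξ => hSN (hFS ξ)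
  -- `P β` bounds the values of the pairing function at arguments up to `β`.
  have hPb (β : Ordinal.{u}) : ∃ μ, β < lam.ord → μ < lam.ord ∧ ∀ η ≤ β, ∀ ξ ≤ β, p η ξ < μ := by
    by_cases hβ : β < lam.ord
    · have h1 (η : Ordinal.{u}) : ∃ μ, η ≤ β → μ < lam.ord ∧ ∀ ξ ≤ β, p η ξ < μ := by
        by_cases hη : η ≤ β
        · obtain ⟨μ, h⟩ := exists_bound_initial hlam.isRegular hβ fun ξ hξ =>
            hp1 η (hη.trans_lt hβ) ξ (hξ.trans_lt hβ)
          exact ⟨μ, fun _ => h⟩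
        · exact ⟨0, fun h => absurd h hη⟩
      choose ν hν using h1
      obtain ⟨μ, hμ, h⟩ := exists_bound_initial hlam.isRegular hβ fun η hη => (hν η hη).1
      exact ⟨μ, fun _ => ⟨hμ, fun η hη ξ hξ => ((hν η hη).2 ξ hξ).trans (h η hη)⟩⟩
    · exact ⟨0, fun h => absurd h hβ⟩
  choose P hP using hPb
  obtain ⟨δ, ⟨⟨c, hc, hδc⟩, hδX⟩, hδH⟩ :=
    hX {α | ∃ η < lam.ord, ∃ ξ < lam.ord, α.1 = p η ξ ∧ F η ∈ F ξ}
      (isClub_closurePoints hlam.isRegular hlam.aleph0_lt (H := fun β => max (H β) (P β))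
        fun β hβ => max_lt (hH β hβ) (hP β hβ).1)
  have hcl' : c.ord < lam.ord := hδc ▸ δ.2
  simp only [Set.mem_ofPred_eq, hδc, max_lt_iff] at hδH
  obtain ⟨M, hM, haM, hMc, hcoll, hFM, hFM'⟩ := hrich c hc (Cardinal.ord_lt_ord.1 hcl')
    fun β hβ => (hδH β hβ).1
  refine ⟨M, hM, fun x hx => haM (ZFSet.mem_insert_of_mem _ (ZFSet.mem_insert_of_mem _ hx)),
    haM (ZFSet.mem_insert _ _), haM (ZFSet.mem_insert_of_mem _ (ZFSet.mem_insert _ _)), ?_⟩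
  have hδ' : (⟨c.ord, hcl'⟩ : Set.Iio lam.ord) = δ := Subtype.ext hδc.symm
  have hR (η ξ : Ordinal.{u}) (hη : η < c.ord) (hξ : ξ < c.ord) :
      R c.ord η ξ ↔ F η ∈ F ξ := by
    have hηl := hη.trans hcl'
    have hξl := hξ.trans hcl'
    constructor
    · rintro ⟨_, α, hα, hαp⟩
      rw [hδ', ← hδX] at hα
      obtain ⟨⟨η', hη', ξ', hξ', he, hm⟩, -⟩ := hα
      obtain ⟨rfl, rfl⟩ := hp2 η hηl ξ hξl η' hη' ξ' hξ' (hαp.symm.trans he)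
      exact hm
    · intro hm
      refine ⟨hcl', ⟨p η ξ, hp1 η hηl ξ hξl⟩, ?_, rfl⟩
      rw [hδ', ← hδX]
      refine ⟨⟨η, hηl, ξ, hξl, rfl, hm⟩, ?_⟩
      have hmax : max η ξ < c.ord := max_lt hη hξ
      rw [Set.mem_Iio, ← hδ']
      exact ((hP _ (hmax.trans hcl')).2 η (le_max_left _ _) ξ (le_max_right _ _)).trans
        (hδH _ hmax).2
  have hdec : Decodes c.ord (R c.ord) (collapse M A) := by
    refine ⟨fun ξ => collapse M (F ξ), fun ξ hξ w => ?_, congrArg (collapse M) hF0⟩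
    rw [mem_collapse]
    constructor
    · rintro ⟨y, hy, hyM, rfl⟩
      obtain ⟨ζ, hζ, rfl⟩ := hFsurj y (hStrans _ (hFS ξ) hy)
      obtain ⟨η, hη, hηζ⟩ := hFM' ζ hζ hyM
      exact ⟨η, hη, (hR η ξ hη hξ).2 (hηζ ▸ hy), congrArg (collapse M) hηζ⟩
    · rintro ⟨η, hη, hE, rfl⟩
      exact ⟨F η, (hR η ξ hη hξ).1 hE, hFM η hη, rfl⟩
  rw [hcoll, pair_mem_graph]
  refine ⟨Ordinal.toZFSet_mem_toZFSet_iff.2 hcl', ?_⟩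
  have hex : ∃ z ∈ ZFSet.vonNeumann lam.ord, Decodes c.ord (R c.ord) z :=
    ⟨_, ZFSet.mem_vonNeumann.2 (rank_collapse_lt hlam.isRegular hMc A), hdec⟩
  simp only [d, Ordinal.rank_toZFSet, hex, dif_pos]
  exact hex.choose_spec.2.unique hc.ord_pos hdec

end MahloLaver

open MahloLaver
theorem lemma3p7 (lam : Cardinal.{u}) (hlam : lam ≠ 0) :
    (IsMahlo lam ∧ Diamond lam (regBelow lam)) ↔
      ∀ N : ZFSet.{u}, N.IsTransitive → ModelsZFCMinus N →
        ClosedUnderSeq (Order.succ lam).ord.toZFSet N →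
        ∃ l : ZFSet.{u}, IsGuessing lam N l := by
  constructor
  · rintro ⟨hm, hd⟩ N hN hZ hcl
    exact exists_isGuessing_of_diamond hm.1 hd hN hZ hcl
  · intro h
    -- `H(θ)` for a regular uncountable `θ > lam⁺`; the maximum covers finite `lam`.
    have hθ := Cardinal.isRegular_succ (le_max_left ℵ₀ (Order.succ lam))
    have hs : Order.succ lam < Order.succ (max ℵ₀ (Order.succ lam)) :=
      Order.lt_succ_iff.2 (le_max_right _ _)
    obtain ⟨l, hl⟩ := h _ (isTransitive_hereditary hθ)
      (modelsZFCMinus_hereditary hθ (Order.lt_succ_iff.2 (le_max_left _ _)))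
      (closedUnderSeq_hereditary hθ (Cardinal.ord_lt_ord.2 hs))
    exact isMahlo_and_diamond_of_isGuessing hθ ((Order.lt_succ lam).trans hs) hlam hl
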